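/- Let $X_0$ be a real random variable, $(\varepsilon_i)_{i\ge1}$ real random variables, and for $\beta\in[-1,1]$ let $X_i=\beta X_{i-1}+\varepsilon_i$ for $i\ge 1$; here $X_0$ and the $\varepsilon_i$ do not depend on $\beta$. Let $n_0\ge 0$ be the pilot sample size and let $\hat\Omega=\hat\Omega(X_0,\dots,X_{n_0-1})\ge 0$ be an estimator of the precision computed from the pilot data, where $\hat\Omega:\mathbb R^{n_0}\to[0,\infty)$ is continuous at every nonzero point (for example $\hat\Omega(v)=1/\sum_k v_k^2$ for $v\neq0$, $\hat\Omega(0)=0$). At the times $j=n_0+1,n_0+2,\dots$ draw Bernoulli variables $B_j$ which, given the stream, are independent with success probabilities $\min\{\hat\Omega X_{j-1}^2,1\}$. The starting time $L$ is the first $j\ge n_0+1$ with $B_j=1$. Fix $l\ge n_0+1$ such that $L=l$ has positive probability for every $\beta\in[-1,1]$, and let $\mathrm P_\beta$ be the conditional probability given $L=l$ when the autoregressive parameter is $\beta$. Assume that $\varepsilon_l,\varepsilon_{l+1},\dots$ are i.i.d. with mean $0$ and variance $\sigma^2\in(0,\infty)$, and that the sequence $(\varepsilon_i)_{i\ge l}$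 is independent of $(X_0,\varepsilon_1,\dots,\varepsilon_{l-1})$ (hence of the starting value $X_{l-1}$). For $c>0$ let $$\tau_c=\inf\Big\{t\ge l:\ \sum_{i=l}^{t}X_{i-1}^2\ge c\Big\},\qquad \hat\beta_{\tau_c}=\frac{\sum_{j=l}^{\tau_c}X_{j-1}X_j}{\sum_{j=l}^{\tau_c}X_{j-1}^2}.$$ Then $\tau_c<\infty$ holds $\mathrm P_\beta$-almost surely for all $\beta\in[-1,1]$ and all $c$, and $$\lim_{c\to\infty}\ \sup_{|\beta|\le1}\ \sup_{x\in\mathbb R}\left|\mathrm P_\beta\left[\sqrt{\sum_{i=l}^{\tau_c}X_{i-1}^2}\,\big(\hat\beta_{\tau_c}-\beta\big)\le x\right]-\Phi(x/\sigma)\right|=0,$$ where $\Phi$ is the standard normal distribution function. -/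

import Mathlib

open MeasureTheory ProbabilityTheory Filter Topology

noncomputable section

namespace SLS

/-- The path of the AR(1) recursion `X_i = β X_{i-1} + e_i` (`i ≥ 1`) started at `X_0 = x₀`.
The entry `e 0` is never used. -/
def stream (β x₀ : ℝ) (e : ℕ → ℝ) : ℕ → ℝ
  | 0 => x₀
  | i + 1 => β * stream β x₀ e i + e (i + 1)

/-- The pilot data `z_1, …, z_{n₀}`, where `z_i = X_{i-1}`. -/
def pilot (n₀ : ℕ) (x : ℕ → ℝ) : Fin n₀ → ℝ := fun k => x k

/-- The streaming leverage score `z_jᵀ Ω̂ z_j` with `z_j = X_{j-1}`, the precision being estimated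
from the pilot data. -/
def leverage {n₀ : ℕ} (Omg : (Fin n₀ → ℝ) → ℝ) (x : ℕ → ℝ) (j : ℕ) : ℝ :=
  x (j - 1) * Omg (pilot n₀ x) * x (j - 1)

/-- The Bernoulli trial at time `j` succeeds. When `u j` is drawn uniformly from `[0, 1]`,
independently of the data, this has conditional probability `min (leverage) 1` given the data. -/
def Success {n₀ : ℕ} (Omg : (Fin n₀ → ℝ) → ℝ) (x u : ℕ → ℝ) (j : ℕ) : Prop :=
  u j < min (leverage Omg x j) 1

/-- The starting time of the block: the first `j ≥ n₀ + 1` whose trial succeeds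
(and `0`, which is no admissible time, if there is none). -/
def startTime {n₀ : ℕ} (Omg : (Fin n₀ → ℝ) → ℝ) (x u : ℕ → ℝ) : ℕ :=
  sInf {j | n₀ + 1 ≤ j ∧ Success Omg x u j}

/-- The observed information `∑_{i=l}^{t} X_{i-1}²`. -/
def blockInfo (x : ℕ → ℝ) (l t : ℕ) : ℝ := ∑ i ∈ Finset.Icc l t, x (i - 1) ^ 2

/-- The stopping time `τ_c = inf {t ≥ l : ∑_{i=l}^{t} X_{i-1}² ≥ c}`. -/
def stopTime (x : ℕ → ℝ) (l : ℕ) (c : ℝ) : ℕ := sInf {t | l ≤ t ∧ c ≤ blockInfo x l t}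

/-- The least squares estimator `∑_{j=l}^{t} X_{j-1} X_j / ∑_{j=l}^{t} X_{j-1}²`. -/
def lsEstimator (x : ℕ → ℝ) (l t : ℕ) : ℝ :=
  (∑ j ∈ Finset.Icc l t, x (j - 1) * x j) / blockInfo x l t

/-- The normalized estimation error `√(∑_{i=l}^{τ_c} X_{i-1}²) (β̂_{τ_c} - β)`. -/
def normalizedError (β : ℝ) (x : ℕ → ℝ) (l : ℕ) (c : ℝ) : ℝ :=
  √(blockInfo x l (stopTime x l c)) * (lsEstimator x l (stopTime x l c) - β)

/-- The conditional probability `P_β = P(· | starting time = l)` when the autoregressive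
parameter is `β`. -/
def condLaw {Ω : Type*} [MeasurableSpace Ω] (P : Measure Ω) (X₀ : Ω → ℝ) (ε U : ℕ → Ω → ℝ)
    {n₀ : ℕ} (Omg : (Fin n₀ → ℝ) → ℝ) (l : ℕ) (β : ℝ) : Measure Ω :=
  ProbabilityTheory.cond P
    {ω | startTime Omg (stream β (X₀ ω) (fun i => ε i ω)) (fun j => U j ω) = l}

end SLS

end

namespace SLS

/-! ### A characteristic function bound for predictably weighted sums -/

section WeightedSum

variable {Ω : Type*} {m0 : MeasurableSpace Ω} {P : Measure Ω}

/-! Since `X_i = β X_{i-1} + ε_i`, the parameter cancels and the normalized error is the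
self-normalized sum `∑ X_{i-1} ε_i / √(∑ X_{i-1}²)`, stopped when the information first reaches `c`.
Stopping by information makes the quadratic variation nearly deterministic, so one Gaussian limit
holds for stable and unit-root parameters alike.

For uniformity in `β` the weights `X_{i-1}/√c` are truncated (`weight`): they are predictable,
bounded by `δ`, and their squares sum to at most `1 + δ²`. With `S` the weighted sum of standardized
innovations and `W` the sum of squared weights, `E exp(iuS + u²W/2)` changes at each step by at most
a multiple of `κ u² E a_n²`, because the characteristic function of an innovation is Gaussian to
second order. Telescoping gives an explicit bound on every event of the initial σ-algebra
(`norm_setIntegral_exp_sub_le`, `norm_setIntegral_exp_sub_gaussian_le`).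

Truncation is harmless outside an exceptional event free of `β`: the pre-block data are large, one
of `O(c)` innovations exceeds `η√c`, or their squares sum to less than `4c`. Elsewhere two
deterministic facts for `|β| ≤ 1` apply: the information dominates a quarter of the noise energy
(`sum_sq_noise_le`), and a path with small noise cannot become large before the information reaches
`c` (`abs_le_of_sum_sq_lt`).

The event `L = l` lies in the initial σ-algebra, and its probability is continuous in `β`
(`continuous_measureReal_startTime_eq`), hence bounded below on `[-1,1]`; dividing by it keeps the
estimates uniform. Lévy's continuity theorem and Pólya's theorem, applied along a violating
sequence, pass to distribution functions (`eventually_forall_abs_cond_sub_cdf_le`). -/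

lemma indepFun_of_indep_comap {m : MeasurableSpace Ω} {ξ : Ω → ℝ} {β : Type*}
    [mβ : MeasurableSpace β] {Z : Ω → β} (hind : Indep m (MeasurableSpace.comap ξ inferInstance) P)
    (hZ : Measurable[m] Z) : IndepFun Z ξ P :=
  (IndepFun_iff_Indep _ _ _).2 (indep_of_indep_of_le_left hind hZ.comap_le)

variable [IsProbabilityMeasure P]

/-- Conditioning on variables that are independent of `ξ`. -/
lemma integral_mul_exp_eq_integral_mul_charFun 
    {ξ : Ω → ℝ} (hξ : Measurable ξ) {G : Ω → ℂ} (hG : Measurable G) {C : ℝ}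
    (hGC : ∀ ω, ‖G ω‖ ≤ C) {a : Ω → ℝ} (ha : Measurable a)
    (hI : IndepFun (fun ω => (G ω, a ω)) ξ P) :
    ∫ ω, G ω * Complex.exp ((a ω * ξ ω : ℝ) * Complex.I) ∂P
      = ∫ ω, G ω * charFun (P.map ξ) (a ω) ∂P := by
  have hZ : Measurable (fun ω => (G ω, a ω)) := hG.prodMk ha
  have hmap := (indepFun_iff_map_prod_eq_prod_map_map hZ.aemeasurable hξ.aemeasurable).1 hI
  have : IsProbabilityMeasure (P.map ξ) := Measure.isProbabilityMeasure_map hξ.aemeasurable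
  have : IsProbabilityMeasure (P.map (fun ω => (G ω, a ω))) :=
    Measure.isProbabilityMeasure_map hZ.aemeasurable
  let F : (ℂ × ℝ) × ℝ → ℂ := fun p => p.1.1 * Complex.exp ((p.1.2 * p.2 : ℝ) * Complex.I)
  have hF : Measurable F := by fun_prop
  have h1 : ∫ ω, G ω * Complex.exp ((a ω * ξ ω : ℝ) * Complex.I) ∂P
      = ∫ p, F p ∂((P.map (fun ω => (G ω, a ω))).prod (P.map ξ)) := by
    rw [← hmap, integral_map (hZ.prodMk hξ).aemeasurable hF.aestronglyMeasurable]
  have hFint : Integrable F ((P.map (fun ω => (G ω, a ω))).prod (P.map ξ)) := by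
    rw [← hmap, integrable_map_measure hF.aestronglyMeasurable (hZ.prodMk hξ).aemeasurable]
    refine Integrable.of_bound (hF.comp (hZ.prodMk hξ)).aestronglyMeasurable C ?_
    refine ae_of_all _ fun ω => ?_
    simp only [F, Function.comp, norm_mul, Complex.norm_exp_ofReal_mul_I, mul_one]
    exact hGC ω
  rw [h1, integral_prod _ hFint, integral_map hZ.aemeasurable]
  · refine integral_congr_ae (ae_of_all _ fun ω => ?_)
    simp only [F]
    rw [integral_const_mul, charFun_apply_real]
    simp
  · exact hF.stronglyMeasurable.integral_prod_right.aestronglyMeasurable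

variable {ℱ : Filtration ℕ m0} {ξ a : ℕ → Ω → ℝ}

lemma measurable_sum_mul (hξ : ∀ i, Measurable[ℱ (i + 1)] (ξ i))
    (ha : ∀ i, Measurable[ℱ i] (a i)) (n : ℕ) :
    Measurable[ℱ n] (fun ω => ∑ i ∈ Finset.range n, a i ω * ξ i ω) := by
  refine Finset.measurable_fun_sum _ fun i hi => ?_
  have hi := Finset.mem_range.1 hi
  exact ((ha i).mono (ℱ.mono hi.le) le_rfl).mul ((hξ i).mono (ℱ.mono hi) le_rfl)

/-- The bound `n ≤ k + 1` expresses predictability: the compensator after step `k` is already known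
before innovation `k`. -/
lemma measurable_sum_sq (ha : ∀ i, Measurable[ℱ i] (a i)) (n k : ℕ) (hn : n ≤ k + 1) :
    Measurable[ℱ k] (fun ω => ∑ i ∈ Finset.range n, a i ω ^ 2) := by
  refine Finset.measurable_fun_sum _ fun i hi => ?_
  have hi := Finset.mem_range.1 hi
  exact ((ha i).mono (ℱ.mono (by omega)) le_rfl).pow_const 2

/-- The compensated characteristic function of a sum with small predictable weights is close
to its initial value. -/
lemma norm_setIntegral_exp_sub_le (hξ : ∀ i, Measurable[ℱ (i + 1)] (ξ i))
    (hind : ∀ i, Indep (ℱ i) (MeasurableSpace.comap (ξ i) inferInstance) P)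
    {μ : Measure ℝ} (hlaw : ∀ i, P.map (ξ i) = μ)
    (ha : ∀ i, Measurable[ℱ i] (a i)) {δ B κ u : ℝ} (haδ : ∀ i ω, |a i ω| ≤ δ)
    (haB : ∀ n ω, ∑ i ∈ Finset.range n, a i ω ^ 2 ≤ B) (hκ : 0 ≤ κ)
    (hμ : ∀ s : ℝ, |s| ≤ |u| * δ → ‖charFun μ s - Complex.exp (-(s ^ 2 / 2 : ℝ))‖ ≤ κ * s ^ 2)
    {A : Set Ω} (hA : MeasurableSet[ℱ 0] A) (n : ℕ) :
    ‖∫ ω in A, Complex.exp ((u * ∑ i ∈ Finset.range n, a i ω * ξ i ω : ℝ) * Complex.I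
        + (u ^ 2 / 2 * ∑ i ∈ Finset.range n, a i ω ^ 2 : ℝ)) ∂P - P.real A‖
      ≤ κ * u ^ 2 * B * Real.exp (u ^ 2 / 2 * B) := by
  set S : ℕ → Ω → ℝ := fun n ω => ∑ i ∈ Finset.range n, a i ω * ξ i ω with hS
  set W : ℕ → Ω → ℝ := fun n ω => ∑ i ∈ Finset.range n, a i ω ^ 2 with hW
  have hA' : MeasurableSet A := ℱ.le 0 _ hA
  have hSm : ∀ n, Measurable[ℱ n] (S n) := measurable_sum_mul hξ ha
  have hWm : ∀ n k, n ≤ k + 1 → Measurable[ℱ k] (W n) := measurable_sum_sq ha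
  have hξ' : ∀ i, Measurable (ξ i) := fun i => (hξ i).mono (ℱ.le _) le_rfl
  have ha' : ∀ i, Measurable (a i) := fun i => (ha i).mono (ℱ.le _) le_rfl
  have hSm' : ∀ n, Measurable (S n) := fun i => (hSm i).mono (ℱ.le _) le_rfl
  have hWm' : ∀ n, Measurable (W n) := fun i => (hWm i i (by omega)).mono (ℱ.le _) le_rfl
  have hexpB : ∀ n ω, Real.exp (u ^ 2 / 2 * W n ω) ≤ Real.exp (u ^ 2 / 2 * B) := fun n ω => by
    gcongr; exact haB n ω
  -- Two separate indices, because the intermediate `E n (n + 1)`, with the compensator one step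
  -- ahead of the sum, is still `ℱ n`-measurable.
  let E : ℕ → ℕ → Ω → ℂ := fun n k ω =>
    Complex.exp ((u * S n ω : ℝ) * Complex.I + (u ^ 2 / 2 * W k ω : ℝ))
  have hEn : ∀ n k ω, ‖E n k ω‖ = Real.exp (u ^ 2 / 2 * W k ω) := fun n k ω => by
    simp only [E, Complex.norm_exp, Complex.add_re, Complex.re_ofReal_mul, Complex.I_re,
      mul_zero, zero_add, Complex.ofReal_re]
  have hEm : ∀ n k, Measurable (E n k) := fun n k => by
    have := hSm' n; have := hWm' k; fun_prop
  have hEint : ∀ n k, Integrable (E n k) P := fun n k =>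
    Integrable.of_bound (hEm n k).aestronglyMeasurable (Real.exp (u ^ 2 / 2 * B))
      (ae_of_all _ fun ω => by rw [hEn]; exact hexpB k ω)
  have hsqint : ∀ i, Integrable (fun ω => a i ω ^ 2) P := fun i =>
    Integrable.of_bound ((ha' i).pow_const 2).aestronglyMeasurable (δ ^ 2)
      (ae_of_all _ fun ω => by
        rw [Real.norm_eq_abs, abs_pow]; exact pow_le_pow_left₀ (abs_nonneg _) (haδ i ω) 2)
  have hstep : ∀ n, ‖∫ ω in A, E (n + 1) (n + 1) ω ∂P - ∫ ω in A, E n n ω ∂P‖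
      ≤ κ * u ^ 2 * Real.exp (u ^ 2 / 2 * B) * ∫ ω, a n ω ^ 2 ∂P := by
    intro n
    -- Both integrands are `G` times one factor: `exp(iu a_n ξ_n)` for the new one and `exp(-(u
    -- a_n)²/2)` for the old one. Averaging over the independent `ξ_n` leaves the characteristic
    -- function minus its Gaussian counterpart.
    let G : Ω → ℂ := A.indicator (E n (n + 1))
    have hGm : Measurable[ℱ n] G := by
      refine Measurable.indicator ?_ (ℱ.mono (Nat.zero_le n) _ hA)
      have := hWm (n + 1) n le_rfl
      exact Complex.measurable_exp.comp
        (((Complex.measurable_ofReal.comp ((hSm n).const_mul u)).mul_const _).add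
          (Complex.measurable_ofReal.comp (this.const_mul _)))
    have hGn : ∀ ω, ‖G ω‖ ≤ Real.exp (u ^ 2 / 2 * B) := fun ω => by
      refine (norm_indicator_le_norm_self _ _).trans ?_
      rw [hEn]; exact hexpB _ ω
    have hGm' : Measurable G := hGm.mono (ℱ.le _) le_rfl
    have e1 : ∫ ω in A, E (n + 1) (n + 1) ω ∂P
        = ∫ ω, G ω * Complex.exp (((u * a n ω) * ξ n ω : ℝ) * Complex.I) ∂P := by
      rw [← integral_indicator hA']
      refine integral_congr_ae (ae_of_all _ fun ω => ?_)
      by_cases hω : ω ∈ A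
      · simp only [G, Set.indicator_of_mem hω, E, ← Complex.exp_add]
        congr 1
        simp only [hS, Finset.sum_range_succ]
        push_cast; ring
      · simp [G, Set.indicator_of_notMem hω]
    have e2 : ∫ ω in A, E n n ω ∂P
        = ∫ ω, G ω * Complex.exp (-((u * a n ω) ^ 2 / 2 : ℝ)) ∂P := by
      rw [← integral_indicator hA']
      refine integral_congr_ae (ae_of_all _ fun ω => ?_)
      by_cases hω : ω ∈ A
      · simp only [G, Set.indicator_of_mem hω, E, ← Complex.exp_add]
        congr 1
        simp only [hW, Finset.sum_range_succ]
        push_cast; ring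
      · simp [G, Set.indicator_of_notMem hω]
    rw [e1, e2, integral_mul_exp_eq_integral_mul_charFun (hξ' n) hGm' hGn
      ((ha' n).const_mul u) (indepFun_of_indep_comap (hind n) (hGm.prodMk ((ha n).const_mul u))),
      hlaw n]
    have hμP : IsProbabilityMeasure μ := hlaw n ▸
      Measure.isProbabilityMeasure_map (hξ' n).aemeasurable
    have i1 : Integrable (fun ω => G ω * charFun μ (u * a n ω)) P := by
      have hcm : Measurable (fun ω => charFun μ (u * a n ω)) :=
        (measurable_charFun (μ := μ)).comp ((ha' n).const_mul u)
      refine Integrable.of_bound (hGm'.mul hcm).aestronglyMeasurable (Real.exp (u ^ 2 / 2 * B))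
        (ae_of_all _ fun ω => ?_)
      rw [norm_mul]
      calc _ ≤ Real.exp (u ^ 2 / 2 * B) * 1 :=
            mul_le_mul (hGn ω) (norm_charFun_le_one _) (norm_nonneg _) (Real.exp_pos _).le
        _ = _ := mul_one _
    have i2 : Integrable (fun ω => G ω * Complex.exp (-((u * a n ω) ^ 2 / 2 : ℝ))) P := by
      have hcm : Measurable (fun ω => Complex.exp (-((u * a n ω) ^ 2 / 2 : ℝ))) := by
        have := ha' n; fun_prop
      refine Integrable.of_bound (hGm'.mul hcm).aestronglyMeasurable (Real.exp (u ^ 2 / 2 * B))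
        (ae_of_all _ fun ω => ?_)
      rw [norm_mul]
      calc _ ≤ Real.exp (u ^ 2 / 2 * B) * 1 := by
            refine mul_le_mul (hGn ω) ?_ (norm_nonneg _) (Real.exp_pos _).le
            rw [← Complex.ofReal_neg, Complex.norm_exp_ofReal, Real.exp_le_one_iff]
            nlinarith [sq_nonneg (u * a n ω)]
        _ = _ := mul_one _
    rw [← integral_sub i1 i2, ← integral_const_mul]
    refine norm_integral_le_of_norm_le ((hsqint n).const_mul _) (ae_of_all _ fun ω => ?_)
    rw [← mul_sub, norm_mul]
    have hb := hμ (u * a n ω) (by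
      rw [abs_mul]; exact mul_le_mul_of_nonneg_left (haδ n ω) (abs_nonneg _))
    calc _ ≤ Real.exp (u ^ 2 / 2 * B) * (κ * (u * a n ω) ^ 2) :=
          mul_le_mul (hGn ω) hb (norm_nonneg _) (Real.exp_pos _).le
      _ = _ := by ring
  have hsum : ∀ n, ‖∫ ω in A, E n n ω ∂P - P.real A‖
      ≤ κ * u ^ 2 * Real.exp (u ^ 2 / 2 * B) * ∫ ω, W n ω ∂P := by
    intro n
    induction n with
    | zero => simp [E, hS, hW, Measure.real]
    | succ n ih =>
      have hWn : ∫ ω, W (n + 1) ω ∂P = ∫ ω, W n ω ∂P + ∫ ω, a n ω ^ 2 ∂P := by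
        simp only [hW, Finset.sum_range_succ]
        exact integral_add (integrable_finsetSum _ fun i _ => hsqint i) (hsqint n)
      rw [hWn, mul_add]
      calc _ = ‖(∫ ω in A, E n n ω ∂P - P.real A)
            + (∫ ω in A, E (n + 1) (n + 1) ω ∂P - ∫ ω in A, E n n ω ∂P)‖ := by congr 1; ring
        _ ≤ _ := (norm_add_le _ _).trans (add_le_add ih (hstep n))
  refine (hsum n).trans ?_
  have hWB : ∫ ω, W n ω ∂P ≤ B := by
    have := integral_mono (μ := P) (f := W n) (g := fun _ => B)
      (integrable_finsetSum _ fun i _ => hsqint i) (integrable_const _) (fun ω => haB n ω)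
    simpa using this
  calc _ ≤ κ * u ^ 2 * Real.exp (u ^ 2 / 2 * B) * B := by gcongr
    _ = _ := by ring

/-- The second moment of a sum with bounded predictable weights. -/
lemma integral_sq_sum_mul_le (hξ : ∀ i, Measurable[ℱ (i + 1)] (ξ i))
    (hind : ∀ i, Indep (ℱ i) (MeasurableSpace.comap (ξ i) inferInstance) P)
    (hL2 : ∀ i, MemLp (ξ i) 2 P) (hmean : ∀ i, ∫ ω, ξ i ω ∂P = 0)
    (hvar : ∀ i, ∫ ω, ξ i ω ^ 2 ∂P = 1)
    (ha : ∀ i, Measurable[ℱ i] (a i)) {δ B : ℝ} (haδ : ∀ i ω, |a i ω| ≤ δ)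
    (haB : ∀ n ω, ∑ i ∈ Finset.range n, a i ω ^ 2 ≤ B) (n : ℕ) :
    Integrable (fun ω => (∑ i ∈ Finset.range n, a i ω * ξ i ω) ^ 2) P ∧
      ∫ ω, (∑ i ∈ Finset.range n, a i ω * ξ i ω) ^ 2 ∂P ≤ B := by
  set S : ℕ → Ω → ℝ := fun n ω => ∑ i ∈ Finset.range n, a i ω * ξ i ω with hS
  have hξ' : ∀ i, Measurable (ξ i) := fun i => (hξ i).mono (ℱ.le _) le_rfl
  have ha' : ∀ i, Measurable (a i) := fun i => (ha i).mono (ℱ.le _) le_rfl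
  have hSm : ∀ n, Measurable[ℱ n] (S n) := measurable_sum_mul hξ ha
  have hSm' : ∀ n, Measurable (S n) := fun i => (hSm i).mono (ℱ.le _) le_rfl
  have haS : ∀ i (f : Ω → ℝ), MemLp f 2 P → MemLp (fun ω => a i ω * f ω) 2 P := fun i f hf => by
    refine MemLp.of_le_mul (c := δ) hf ((ha' i).aestronglyMeasurable.mul hf.1) ?_
    refine ae_of_all _ fun ω => ?_
    rw [norm_mul]
    exact mul_le_mul_of_nonneg_right (haδ i ω) (norm_nonneg _)
  have hSL : ∀ n, MemLp (S n) 2 P := fun n => by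
    refine memLp_finsetSum _ fun i _ => haS i _ (hL2 i)
  have hsqint : ∀ i, Integrable (fun ω => a i ω ^ 2) P := fun i =>
    Integrable.of_bound ((ha' i).pow_const 2).aestronglyMeasurable (δ ^ 2)
      (ae_of_all _ fun ω => by
        rw [Real.norm_eq_abs, abs_pow]; exact pow_le_pow_left₀ (abs_nonneg _) (haδ i ω) 2)
  have key : ∀ n, ∫ ω, S n ω ^ 2 ∂P = ∑ i ∈ Finset.range n, ∫ ω, a i ω ^ 2 ∂P := by
    intro n
    induction n with
    | zero => simp [hS]
    | succ n ih =>
      rw [Finset.sum_range_succ, ← ih]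
      -- The cross term vanishes because `a_n S_n` is determined before the centered `ξ_n`.
      have hI1 : IndepFun (fun ω => a n ω * S n ω) (ξ n) P :=
        indepFun_of_indep_comap (hind n) ((ha n).mul (hSm n))
      have hI2 : IndepFun (fun ω => a n ω ^ 2) (fun ω => ξ n ω ^ 2) P :=
        (indepFun_of_indep_comap (hind n) (ha n)).comp (φ := fun x => x ^ 2) (ψ := fun x => x ^ 2)
          (by fun_prop) (by fun_prop)
      have c1 : ∫ ω, a n ω * S n ω * ξ n ω ∂P = 0 := by
        have := hI1.integral_fun_mul_eq_mul_integral (haS n _ (hSL n)).1 (hL2 n).1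
        rw [this, hmean n, mul_zero]
      have c2 : ∫ ω, a n ω ^ 2 * ξ n ω ^ 2 ∂P = ∫ ω, a n ω ^ 2 ∂P := by
        have := hI2.integral_fun_mul_eq_mul_integral (hsqint n).1 (hL2 n).integrable_sq.1
        rw [this, hvar n, mul_one]
      have j1 : Integrable (fun ω => S n ω ^ 2) P := (hSL n).integrable_sq
      have j2 : Integrable (fun ω => a n ω * S n ω * ξ n ω) P :=
        (haS n _ (hSL n)).integrable_mul (hL2 n)
      have j3 : Integrable (fun ω => a n ω ^ 2 * ξ n ω ^ 2) P := by
        simpa only [mul_pow] using (haS n _ (hL2 n)).integrable_sq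
      calc ∫ ω, S (n + 1) ω ^ 2 ∂P
          = ∫ ω, (S n ω ^ 2 + 2 * (a n ω * S n ω * ξ n ω)) + a n ω ^ 2 * ξ n ω ^ 2 ∂P := by
            refine integral_congr_ae (ae_of_all _ fun ω => ?_)
            simp only [hS, Finset.sum_range_succ]; ring
        _ = ∫ ω, S n ω ^ 2 ∂P + ∫ ω, a n ω ^ 2 ∂P := by
            have j4 : Integrable (fun ω => S n ω ^ 2 + 2 * (a n ω * S n ω * ξ n ω)) P :=
              j1.add (j2.const_mul 2)
            rw [integral_add j4 j3, integral_add j1 (j2.const_mul 2),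
              integral_const_mul, c1, c2]; ring
  refine ⟨(hSL n).integrable_sq, ?_⟩
  rw [key n, ← integral_finsetSum _ fun i _ => hsqint i]
  have := integral_mono (μ := P) (f := fun ω => ∑ i ∈ Finset.range n, a i ω ^ 2) (g := fun _ => B)
    (integrable_finsetSum _ fun i _ => hsqint i) (integrable_const _) (fun ω => haB n ω)
  simpa using this

end WeightedSum

/-! ### Deterministic properties of autoregressive paths -/

section Path

variable {β : ℝ} {x e : ℕ → ℝ}

/-- From `e_i = x_{i+1} - β x_i` one gets `e_i² ≤ 2 x_{i+1}² + 2 x_i²`, and each `x_i²` is counted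
at most twice. This bounds the stopping time uniformly over `|β| ≤ 1`, without any stability of the
recursion. -/
lemma sum_sq_noise_le (hβ : |β| ≤ 1) (hx : ∀ i, x (i + 1) = β * x i + e i) (n : ℕ) :
    ∑ i ∈ Finset.range n, e i ^ 2 ≤ 4 * ∑ i ∈ Finset.range (n + 1), x i ^ 2 := by
  have hβ2 : β ^ 2 ≤ 1 := (sq_le_one_iff_abs_le_one β).2 hβ
  have h1 : ∀ i, e i ^ 2 ≤ 2 * x (i + 1) ^ 2 + 2 * x i ^ 2 := fun i => by
    have : e i = x (i + 1) - β * x i := by rw [hx]; ring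
    rw [this]
    nlinarith [sq_nonneg (x (i + 1) + β * x i), mul_nonneg (sub_nonneg.2 hβ2) (sq_nonneg (x i))]
  have h2 : ∑ i ∈ Finset.range n, x (i + 1) ^ 2 ≤ ∑ i ∈ Finset.range (n + 1), x i ^ 2 := by
    rw [Finset.sum_range_succ']; nlinarith [sq_nonneg (x 0)]
  have h3 : ∑ i ∈ Finset.range n, x i ^ 2 ≤ ∑ i ∈ Finset.range (n + 1), x i ^ 2 := by
    rw [Finset.sum_range_succ]; nlinarith [sq_nonneg (x n)]
  calc _ ≤ ∑ i ∈ Finset.range n, (2 * x (i + 1) ^ 2 + 2 * x i ^ 2) :=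
        Finset.sum_le_sum fun i _ => h1 i
    _ = 2 * ∑ i ∈ Finset.range n, x (i + 1) ^ 2 + 2 * ∑ i ∈ Finset.range n, x i ^ 2 := by
        rw [Finset.sum_add_distrib, Finset.mul_sum, Finset.mul_sum]
    _ ≤ _ := by linarith

/-- The modulus grows by at most `r` per step since `|β| ≤ 1`. It is used backwards: a large value
forces its predecessors to be large. -/
lemma abs_add_le_of_noise_le (hβ : |β| ≤ 1) (hx : ∀ i, x (i + 1) = β * x i + e i) {N : ℕ} {r : ℝ}
    (he : ∀ j < N, |e j| ≤ r) (i k : ℕ) (hik : i + k ≤ N) : |x (i + k)| ≤ |x i| + k * r := by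
  induction k with
  | zero => simp
  | succ k ih =>
    have h1 := ih (by omega)
    have h2 := he (i + k) (by omega)
    rw [← add_assoc, hx]
    have h3 : |β * x (i + k)| ≤ |x (i + k)| := by
      rw [abs_mul]; exact mul_le_of_le_one_left (abs_nonneg _) hβ
    have := abs_add_le (β * x (i + k)) (e (i + k))
    push_cast; linarith

/-- A path with small noise cannot reach a large value before the accumulated information is
large, because it must have stayed large for a while. -/
lemma abs_le_of_sum_sq_lt (hβ : |β| ≤ 1) (hx : ∀ i, x (i + 1) = β * x i + e i) {N K : ℕ}
    {r D c : ℝ} (hD : 0 < D) (he : ∀ j < N, |e j| ≤ r) (hx0 : |x 0| ≤ r)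
    (hK : (K + 1) * r ≤ D / 2) (hc : c ≤ K * (D / 2) ^ 2) {m : ℕ} (hm : m ≤ N)
    (hv : ∑ i ∈ Finset.range m, x i ^ 2 < c) : |x m| ≤ D := by
  by_contra! hlt
  have hr : 0 ≤ r := (abs_nonneg _).trans hx0
  have key : ∀ k ≤ K, k ≤ m → D / 2 < |x (m - k)| := by
    intro k hk hkm
    have := abs_add_le_of_noise_le hβ hx he (m - k) k (by omega)
    rw [Nat.sub_add_cancel hkm] at this
    have hk' : (k : ℝ) * r ≤ (K + 1) * r := by
      have : (k : ℝ) ≤ K := by exact_mod_cast hk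
      gcongr; linarith
    linarith
  -- If `m ≤ K`, going back to time `0` contradicts the small initial value. Otherwise the last `K`
  -- values alone contribute information at least `c`.
  rcases le_or_gt m K with h | h
  · have := key m h le_rfl
    have hr' : r ≤ (K + 1) * r := by nlinarith [mul_nonneg (Nat.cast_nonneg (α := ℝ) K) hr]
    simp only [Nat.sub_self] at this
    linarith
  · have : (K : ℝ) * (D / 2) ^ 2 ≤ ∑ i ∈ Finset.range m, x i ^ 2 := by
      calc (K : ℝ) * (D / 2) ^ 2 = ∑ i ∈ Finset.Ico (m - K) m, (D / 2) ^ 2 := by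
            rw [Finset.sum_const, Nat.card_Ico, nsmul_eq_mul]
            congr 2; omega
        _ ≤ ∑ i ∈ Finset.Ico (m - K) m, x i ^ 2 := by
            refine Finset.sum_le_sum fun i hi => ?_
            rw [Finset.mem_Ico] at hi
            have := key (m - i) (by omega) (by omega)
            rw [Nat.sub_sub_self hi.2.le] at this
            rw [← sq_abs (x i)]
            gcongr
        _ ≤ _ := Finset.sum_le_sum_of_subset_of_nonneg
            (fun i hi => by simp only [Finset.mem_Ico, Finset.mem_range] at *; omega)
            (fun i _ _ => sq_nonneg _)
    linarith

end Path

/-! ### Tail estimates for the innovations -/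

section Noise

variable {Ω : Type*} {m0 : MeasurableSpace Ω} {P : Measure Ω}

variable {e : ℕ → Ω → ℝ}

lemma ae_tendsto_sum_sq_div (hind : Pairwise fun i j => IndepFun (e i) (e j) P)
    (hid : ∀ i, IdentDistrib (e i) (e 0) P P) (hL2 : MemLp (e 0) 2 P) :
    ∀ᵐ ω ∂P, Tendsto (fun n : ℕ => (∑ i ∈ Finset.range n, e i ω ^ 2) / n) atTop
      (𝓝 (∫ ω, e 0 ω ^ 2 ∂P)) :=
  strong_law_ae_real (fun i ω => e i ω ^ 2) hL2.integrable_sq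
    (fun i j hij => (hind hij).comp (φ := fun y => y ^ 2) (ψ := fun y => y ^ 2)
      (by fun_prop) (by fun_prop))
    (fun i => (hid i).comp (u := fun y => y ^ 2) (by fun_prop))

lemma ae_tendsto_sum_sq_atTop (hind : Pairwise fun i j => IndepFun (e i) (e j) P)
    (hid : ∀ i, IdentDistrib (e i) (e 0) P P) (hL2 : MemLp (e 0) 2 P)
    (hpos : 0 < ∫ ω, e 0 ω ^ 2 ∂P) :
    ∀ᵐ ω ∂P, Tendsto (fun n : ℕ => ∑ i ∈ Finset.range n, e i ω ^ 2) atTop atTop := by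
  filter_upwards [ae_tendsto_sum_sq_div hind hid hL2] with ω hω
  refine (hω.pos_mul_atTop hpos tendsto_natCast_atTop_atTop).congr' ?_
  filter_upwards [eventually_gt_atTop 0] with n hn
  field_simp

variable [IsProbabilityMeasure P]

/-- Chebyshev's inequality restricted to the tail event bounds the expression by `η⁻² E[f²; |f| >
η√c]`, which vanishes by dominated convergence. The resulting `o(1/c)` tail survives a union bound
over `O(c)` innovations. -/
lemma tendsto_mul_measureReal_sqrt_lt {f : Ω → ℝ} (hf : Measurable f) (hL2 : MemLp f 2 P)
    {η : ℝ} (hη : 0 < η) :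
    Tendsto (fun c : ℝ => c * P.real {ω | η * √c < |f ω|}) atTop (𝓝 0) := by
  have hfsq : Integrable (fun ω => f ω ^ 2) P := hL2.integrable_sq
  have hms : ∀ c : ℝ, MeasurableSet {ω | η * √c < |f ω|} := fun c =>
    measurableSet_lt measurable_const (hf.abs)
  have h1 : Tendsto (fun c : ℝ => ∫ ω, {ω | η * √c < |f ω|}.indicator (fun ω => f ω ^ 2) ω ∂P)
      atTop (𝓝 (∫ _, (0 : ℝ) ∂P)) := by
    refine tendsto_integral_filter_of_dominated_convergence (fun ω => f ω ^ 2) ?_ ?_ hfsq ?_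
    · exact Eventually.of_forall fun c => (hfsq.indicator (hms c)).1
    · refine Eventually.of_forall fun c => ae_of_all _ fun ω => ?_
      refine (norm_indicator_le_norm_self _ _).trans ?_
      rw [Real.norm_of_nonneg (sq_nonneg _)]
    · refine ae_of_all _ fun ω => ?_
      have : ∀ᶠ c : ℝ in atTop, |f ω| ≤ η * √c :=
        (Real.tendsto_sqrt_atTop.const_mul_atTop hη).eventually_ge_atTop _
      refine tendsto_const_nhds.congr' ?_
      filter_upwards [this] with c hc
      rw [Set.indicator_of_notMem]
      simpa using hc
  have h2 := h1.const_mul (1 / η ^ 2)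
  simp only [integral_zero, mul_zero] at h2
  refine squeeze_zero' ?_ ?_ h2
  · filter_upwards [eventually_ge_atTop 0] with c hc
    positivity
  · filter_upwards [eventually_ge_atTop 0] with c hc
    rw [integral_indicator (hms c)]
    have : ∫ ω in {ω | η * √c < |f ω|}, η ^ 2 * c ∂P ≤ ∫ ω in {ω | η * √c < |f ω|}, f ω ^ 2 ∂P := by
      refine setIntegral_mono_on (integrable_const _).integrableOn hfsq.integrableOn (hms c) ?_
      intro ω hω
      have hω : η * √c < |f ω| := hω
      calc η ^ 2 * c = (η * √c) ^ 2 := by rw [mul_pow, Real.sq_sqrt hc]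
        _ ≤ |f ω| ^ 2 := by gcongr
        _ = f ω ^ 2 := sq_abs _
    rw [setIntegral_const, smul_eq_mul] at this
    rw [div_mul_eq_mul_div, one_mul, le_div_iff₀ (by positivity)]
    linarith

/-- The largest of the first `O(c)` innovations is `o(√c)` in probability. -/
lemma tendsto_measureReal_exists_noise_gt (hm : ∀ i, Measurable (e i))
    (hid : ∀ i, IdentDistrib (e i) (e 0) P P) (hL2 : MemLp (e 0) 2 P) {η M : ℝ} (hη : 0 < η)
    (hM : 0 < M) :
    Tendsto (fun c : ℝ => P.real {ω | ∃ j < ⌈M * c⌉₊, η * √c < |e j ω|}) atTop (𝓝 0) := by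
  have h := (tendsto_mul_measureReal_sqrt_lt (hm 0) hL2 hη).const_mul (M + 1)
  rw [mul_zero] at h
  refine squeeze_zero' (Eventually.of_forall fun c => measureReal_nonneg) ?_ h
  filter_upwards [eventually_ge_atTop 1] with c hc
  have hsub : {ω | ∃ j < ⌈M * c⌉₊, η * √c < |e j ω|}
      ⊆ ⋃ j ∈ Finset.range ⌈M * c⌉₊, {ω | η * √c < |e j ω|} := by
    rintro ω ⟨j, hj, h⟩
    simp only [Set.mem_iUnion, Finset.mem_range]
    exact ⟨j, hj, h⟩
  have heq : ∀ j, P.real {ω | η * √c < |e j ω|} = P.real {ω | η * √c < |e 0 ω|} := fun j => by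
    have := (hid j).measure_mem_eq (s := {y | η * √c < |y|})
      (measurableSet_lt measurable_const measurable_id.abs)
    exact congrArg ENNReal.toReal this
  calc _ ≤ P.real (⋃ j ∈ Finset.range ⌈M * c⌉₊, {ω | η * √c < |e j ω|}) :=
        measureReal_mono hsub (measure_ne_top _ _)
    _ ≤ ∑ j ∈ Finset.range ⌈M * c⌉₊, P.real {ω | η * √c < |e j ω|} :=
        measureReal_biUnion_finset_le _ _
    _ = ⌈M * c⌉₊ * P.real {ω | η * √c < |e 0 ω|} := by
        simp [heq]
    _ ≤ ((M + 1) * c) * P.real {ω | η * √c < |e 0 ω|} := by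
        gcongr
        have := (Nat.ceil_lt_add_one (a := M * c) (by positivity)).le
        nlinarith
    _ = _ := by ring

/-- After `O(c)` steps the sum of the squared innovations exceeds `4 c` with high probability. -/
lemma tendsto_measureReal_sum_sq_lt (hm : ∀ i, Measurable (e i))
    (hind : Pairwise fun i j => IndepFun (e i) (e j) P)
    (hid : ∀ i, IdentDistrib (e i) (e 0) P P) (hL2 : MemLp (e 0) 2 P)
    (hpos : 0 < ∫ ω, e 0 ω ^ 2 ∂P) :
    Tendsto (fun c : ℝ => P.real {ω | ∑ i ∈ Finset.range ⌈8 / (∫ ω, e 0 ω ^ 2 ∂P) * c⌉₊, e i ω ^ 2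
      < 4 * c}) atTop (𝓝 0) := by
  set v := ∫ ω, e 0 ω ^ 2 ∂P
  have hmeas : ∀ n : ℕ, Measurable fun ω => (∑ i ∈ Finset.range n, e i ω ^ 2) / n := fun n =>
    (Finset.measurable_fun_sum _ fun i _ => (hm i).pow_const 2).div_const _
  have h1 : TendstoInMeasure P (fun (n : ℕ) ω => (∑ i ∈ Finset.range n, e i ω ^ 2) / n) atTop
      (fun _ => v) :=
    tendstoInMeasure_of_tendsto_ae (fun n => (hmeas n).aestronglyMeasurable)
      (ae_tendsto_sum_sq_div hind hid hL2)
  have h2 := (tendstoInMeasure_iff_measureReal_dist.1 h1) (v / 4) (by positivity)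
  have hceil : Tendsto (fun c : ℝ => ⌈8 / v * c⌉₊) atTop atTop :=
    tendsto_nat_ceil_atTop.comp (tendsto_id.const_mul_atTop (by positivity))
  refine squeeze_zero' (Eventually.of_forall fun c => measureReal_nonneg) ?_ (h2.comp hceil)
  filter_upwards [eventually_gt_atTop 0] with c hc
  refine measureReal_mono fun ω hω => ?_
  have hω : _ < 4 * c := hω
  change v / 4 ≤ dist _ v
  set n := ⌈8 / v * c⌉₊
  have hn : 8 / v * c ≤ n := Nat.le_ceil _
  have hn0 : (0 : ℝ) < n := lt_of_lt_of_le (by positivity) hn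
  have h3 : (∑ i ∈ Finset.range n, e i ω ^ 2) / n ≤ v / 2 := by
    rw [div_le_iff₀ hn0]
    have : 8 * c ≤ v * n := by
      have := mul_le_mul_of_nonneg_left hn hpos.le
      rwa [← mul_assoc, mul_div_cancel₀ _ hpos.ne'] at this
    linarith
  rw [Real.dist_eq, abs_sub_comm]
  exact le_trans (by linarith) (le_abs_self _)

/-- The second order expansion of the characteristic function of a standardized variable,
compared with the Gaussian one. -/
lemma exists_norm_charFun_sub_exp_le {f : Ω → ℝ} (hf : Measurable f) (h0 : ∫ ω, f ω ∂P = 0)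
    (h1 : ∫ ω, f ω ^ 2 ∂P = 1) {κ : ℝ} (hκ : 0 < κ) :
    ∃ r > 0, ∀ s : ℝ, |s| ≤ r →
      ‖charFun (P.map f) s - Complex.exp (-(s ^ 2 / 2 : ℝ))‖ ≤ κ * s ^ 2 := by
  have hT := taylor_charFun_two hf.aemeasurable h0 h1
  obtain ⟨r, hr, hball⟩ := Metric.eventually_nhds_iff.1 (hT.bound (half_pos hκ))
  -- The bound `1` makes the second-order exponential estimate applicable; the bound `κ` gives `s² ≤
  -- |s| ≤ κ`, so the quartic remainder fits into the unused `κ/2 · s²`.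
  refine ⟨min (r / 2) (min 1 κ), by positivity, fun s hs => ?_⟩
  obtain ⟨hs1, hs2, hs3⟩ : |s| ≤ r / 2 ∧ |s| ≤ 1 ∧ |s| ≤ κ := by simpa using hs
  have b1 := hball (y := s) (by rw [Real.dist_eq, sub_zero]; linarith)
  have hs4 : s ^ 2 ≤ |s| := by
    rw [← sq_abs]; nlinarith [abs_nonneg s]
  have hn : ‖((-(s ^ 2 / 2) : ℝ) : ℂ)‖ = s ^ 2 / 2 := by
    rw [Complex.norm_real, norm_neg, Real.norm_of_nonneg (by positivity)]
  have b2 := Complex.norm_exp_sub_one_sub_id_le (x := ((-(s ^ 2 / 2) : ℝ) : ℂ))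
    (by rw [hn]; linarith)
  rw [hn] at b2
  rw [Real.norm_of_nonneg (sq_nonneg s)] at b1
  calc _ = ‖(charFun (P.map f) s - (1 - (s : ℂ) ^ 2 / 2))
        - (Complex.exp ((-(s ^ 2 / 2) : ℝ) : ℂ) - 1 - ((-(s ^ 2 / 2) : ℝ) : ℂ))‖ := by
        congr 1; push_cast; ring
    _ ≤ κ / 2 * s ^ 2 + (s ^ 2 / 2) ^ 2 := (norm_sub_le _ _).trans (add_le_add b1 b2)
    _ ≤ _ := by nlinarith [mul_le_mul_of_nonneg_left (hs4.trans hs3) (sq_nonneg s)]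

end Noise

/-! ### The normalized error as a weighted sum -/

section Representation

lemma sum_Icc_eq_sum_range {f : ℕ → ℝ} {l : ℕ} (t : ℕ) :
    ∑ i ∈ Finset.Icc l t, f i = ∑ i ∈ Finset.range (t + 1 - l), f (l + i) := by
  rw [← Finset.sum_Ico_eq_sum_range]
  rfl

lemma blockInfo_eq_sum_range (X : ℕ → ℝ) {l : ℕ} (hl : 1 ≤ l) (t : ℕ) :
    blockInfo X l t = ∑ i ∈ Finset.range (t + 1 - l), X (l - 1 + i) ^ 2 := by
  rw [blockInfo, sum_Icc_eq_sum_range]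
  refine Finset.sum_congr rfl fun i _ => ?_
  congr 2; omega

/-- The value `0` is excluded because it is also the infimum of the empty set. -/
lemma nat_sInf_eq_iff {p : ℕ → Prop} {n : ℕ} (hn : n ≠ 0) :
    sInf {t | p t} = n ↔ p n ∧ ∀ m < n, ¬ p m := by
  constructor
  · rintro rfl
    exact ⟨Nat.sInf_mem (Nat.nonempty_of_sInf_eq_succ (k := sInf {t | p t} - 1) (by omega)),
      fun m hm => Nat.notMem_of_lt_sInf hm⟩
  · rintro ⟨h1, h2⟩
    refine le_antisymm (Nat.sInf_le h1) (le_csInf ⟨n, h1⟩ fun m hm => ?_)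
    by_contra! h
    exact h2 m h hm

/-- At the stopping time the number `n` of summands is the first one with information at
least `c`, and the normalized error is a self-normalized weighted sum of the innovations. -/
lemma exists_normalizedError_eq {β c : ℝ} {X e : ℕ → ℝ} {l N : ℕ} (hl : 1 ≤ l) (hc : 0 < c)
    (hX : ∀ i, X (l - 1 + (i + 1)) = β * X (l - 1 + i) + e i)
    (hN : c ≤ ∑ i ∈ Finset.range (N + 1), X (l - 1 + i) ^ 2) :
    ∃ n ≤ N + 1, c ≤ ∑ i ∈ Finset.range n, X (l - 1 + i) ^ 2 ∧
      (∀ i < n, ∑ j ∈ Finset.range i, X (l - 1 + j) ^ 2 < c) ∧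
      normalizedError β X l c
        = (∑ i ∈ Finset.range n, X (l - 1 + i) * e i)
          / √(∑ i ∈ Finset.range n, X (l - 1 + i) ^ 2) := by
  have hmem : l + N ∈ {t | l ≤ t ∧ c ≤ blockInfo X l t} := by
    refine ⟨by omega, ?_⟩
    rw [blockInfo_eq_sum_range X hl, show l + N + 1 - l = N + 1 by omega]
    exact hN
  have hτ := Nat.sInf_mem ⟨_, hmem⟩
  have hle : stopTime X l c ≤ l + N := Nat.sInf_le hmem
  change stopTime X l c ∈ _ at hτ
  have hnot : ∀ t < stopTime X l c, l ≤ t → blockInfo X l t < c := fun t ht hlt => by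
    by_contra! h
    exact absurd (Nat.sInf_le (s := {t | l ≤ t ∧ c ≤ blockInfo X l t}) ⟨hlt, h⟩) (not_le.2 ht)
  obtain ⟨hτl, hτc⟩ := hτ
  set τ := stopTime X l c with hτdef
  have hbτ : blockInfo X l τ = ∑ i ∈ Finset.range (τ + 1 - l), X (l - 1 + i) ^ 2 :=
    blockInfo_eq_sum_range X hl τ
  refine ⟨τ + 1 - l, by omega, hbτ ▸ hτc, fun i hi => ?_, ?_⟩
  · rcases Nat.eq_zero_or_pos i with rfl | hpos
    · simpa using hc
    · have := hnot (l + i - 1) (by omega) (by omega)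
      rwa [blockInfo_eq_sum_range X hl, show l + i - 1 + 1 - l = i by omega] at this
  · rw [normalizedError, lsEstimator, ← hτdef, ← hbτ, sum_Icc_eq_sum_range]
    have hpos : 0 < blockInfo X l τ := hc.trans_le hτc
    -- Inserting the recursion splits off `β` times the information, which is exactly what centering
    -- the estimator removes.
    have hnum : ∑ i ∈ Finset.range (τ + 1 - l), X (l + i - 1) * X (l + i)
        = β * blockInfo X l τ + ∑ i ∈ Finset.range (τ + 1 - l), X (l - 1 + i) * e i := by
      rw [hbτ, Finset.mul_sum, ← Finset.sum_add_distrib]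
      refine Finset.sum_congr rfl fun i _ => ?_
      have h1 : l + i = l - 1 + (i + 1) := by omega
      rw [show l + i - 1 = l - 1 + i by omega, h1, hX]
      ring
    rw [hnum]
    have hsq := Real.sqrt_pos.2 hpos
    rw [eq_div_iff hsq.ne', mul_right_comm, Real.mul_self_sqrt hpos.le]
    field_simp
    ring

/-- The predictable weight attached to the innovation number `i`: the normalized value of the
path, as long as it is small and the information is still below `c`. -/
noncomputable def weight (δ c : ℝ) (x : ℕ → ℝ) (i : ℕ) : ℝ :=
  open scoped Classical in
  if ∑ j ∈ Finset.range i, x j ^ 2 < c ∧ |x i| ≤ δ * √c then x i / √c else 0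

variable {δ c : ℝ} {x : ℕ → ℝ}

lemma abs_weight_le (hδ : 0 ≤ δ) (hc : 0 < c) (i : ℕ) : |weight δ c x i| ≤ δ := by
  unfold weight
  split_ifs with h
  · rw [abs_div, abs_of_pos (Real.sqrt_pos.2 hc), div_le_iff₀ (Real.sqrt_pos.2 hc)]
    exact h.2
  · simpa using hδ

lemma sq_weight_le (hc : 0 < c) (i : ℕ) : weight δ c x i ^ 2 ≤ x i ^ 2 / c := by
  unfold weight
  split_ifs with h
  · rw [div_pow, Real.sq_sqrt hc.le]
  · rw [zero_pow two_ne_zero]; positivity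

/-- Before the last nonzero weight the information is below `c`, so the earlier squares sum to at
most `1`; that last weight overshoots by at most `δ²`, and afterwards all weights vanish. -/
lemma sum_sq_weight_le (hδ : 0 ≤ δ) (hc : 0 < c) (n : ℕ) :
    ∑ i ∈ Finset.range n, weight δ c x i ^ 2 ≤ 1 + δ ^ 2 := by
  induction n with
  | zero => rw [Finset.sum_range_zero]; positivity
  | succ n ih =>
    rw [Finset.sum_range_succ]
    by_cases h : ∑ j ∈ Finset.range n, x j ^ 2 < c
    · have h1 : ∑ i ∈ Finset.range n, weight δ c x i ^ 2 ≤ 1 := by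
        calc _ ≤ ∑ i ∈ Finset.range n, x i ^ 2 / c := Finset.sum_le_sum fun i _ => sq_weight_le hc i
          _ = (∑ i ∈ Finset.range n, x i ^ 2) / c := by rw [Finset.sum_div]
          _ ≤ 1 := by rw [div_le_one hc]; exact h.le
      have h2 : weight δ c x n ^ 2 ≤ δ ^ 2 := by
        rw [← sq_abs]; exact pow_le_pow_left₀ (abs_nonneg _) (abs_weight_le hδ hc n) 2
      linarith
    · have : weight δ c x n = 0 := by
        unfold weight; rw [if_neg]; exact fun h' => h h'.1
      rw [this]; simpa using ih

/-- When the path stays small up to the stopping time, the normalized error is the weighted sum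
of the innovations, up to a factor close to one. -/
lemma normalizedError_eq_weight {β : ℝ} {X e : ℕ → ℝ} {l N : ℕ} (hl : 1 ≤ l) (hc : 0 < c)
    (hX : ∀ i, X (l - 1 + (i + 1)) = β * X (l - 1 + i) + e i)
    (hN : c ≤ ∑ i ∈ Finset.range (N + 1), X (l - 1 + i) ^ 2)
    (hsmall : ∀ m ≤ N, ∑ i ∈ Finset.range m, X (l - 1 + i) ^ 2 < c → |X (l - 1 + m)| ≤ δ * √c) :
    1 ≤ ∑ i ∈ Finset.range (N + 1), weight δ c (fun i => X (l - 1 + i)) i ^ 2 ∧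
    normalizedError β X l c
      = (∑ i ∈ Finset.range (N + 1), weight δ c (fun i => X (l - 1 + i)) i * e i)
        / √(∑ i ∈ Finset.range (N + 1), weight δ c (fun i => X (l - 1 + i)) i ^ 2) := by
  obtain ⟨n, hn, hcn, hlt, hEq⟩ := exists_normalizedError_eq hl hc hX hN
  set x : ℕ → ℝ := fun i => X (l - 1 + i) with hx
  have hw : ∀ i < n, weight δ c x i = x i / √c := fun i hi => by
    unfold weight
    rw [if_pos ⟨hlt i hi, hsmall i (by omega) (hlt i hi)⟩]
  have hw0 : ∀ i, n ≤ i → weight δ c x i = 0 := fun i hi => by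
    unfold weight
    rw [if_neg]
    rintro ⟨h1, -⟩
    have : ∑ j ∈ Finset.range n, x j ^ 2 ≤ ∑ j ∈ Finset.range i, x j ^ 2 :=
      Finset.sum_le_sum_of_subset_of_nonneg (Finset.range_mono hi) fun _ _ _ => sq_nonneg _
    linarith
  have hcut : ∀ g : ℕ → ℝ, (∀ i, n ≤ i → g i = 0) →
      ∑ i ∈ Finset.range (N + 1), g i = ∑ i ∈ Finset.range n, g i := fun g hg => by
    refine (Finset.sum_subset (Finset.range_mono hn) fun i _ hi => hg i ?_).symm
    simpa using hi
  have hsc : 0 < √c := Real.sqrt_pos.2 hc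
  have e1 : ∑ i ∈ Finset.range (N + 1), weight δ c x i ^ 2
      = (∑ i ∈ Finset.range n, x i ^ 2) / c := by
    rw [hcut _ fun i hi => by rw [hw0 i hi]; simp, Finset.sum_div]
    refine Finset.sum_congr rfl fun i hi => ?_
    rw [hw i (Finset.mem_range.1 hi), div_pow, Real.sq_sqrt hc.le]
  have e2 : ∑ i ∈ Finset.range (N + 1), weight δ c x i * e i
      = (∑ i ∈ Finset.range n, x i * e i) / √c := by
    rw [hcut _ fun i hi => by rw [hw0 i hi]; simp, Finset.sum_div]
    refine Finset.sum_congr rfl fun i hi => ?_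
    rw [hw i (Finset.mem_range.1 hi)]; ring
  refine ⟨?_, ?_⟩
  · rw [e1, le_div_iff₀ hc, one_mul]; exact hcn
  · rw [e1, e2, hEq, Real.sqrt_div' _ hc.le, div_div_div_cancel_right₀ hsc.ne']

end Representation

/-! ### Bounds and measurability for the path, the weights and the stopped error. -/

section Stream

lemma stream_succ_of_one_le {β x₀ : ℝ} {e : ℕ → ℝ} {l : ℕ} (hl : 1 ≤ l) (i : ℕ) :
    stream β x₀ e (l - 1 + (i + 1)) = β * stream β x₀ e (l - 1 + i) + e (l + i) := by
  rw [← add_assoc, stream]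
  congr 2; omega

/-- The right-hand side is free of `β`, so one exceptional event controls the starting value of the
block for all parameters. -/
lemma abs_stream_le {β x₀ : ℝ} {e : ℕ → ℝ} (hβ : |β| ≤ 1) (k : ℕ) :
    |stream β x₀ e k| ≤ |x₀| + ∑ i ∈ Finset.range k, |e (i + 1)| := by
  induction k with
  | zero => simp [stream]
  | succ k ih =>
    rw [stream, Finset.sum_range_succ]
    have h3 : |β * stream β x₀ e k| ≤ |stream β x₀ e k| := by
      rw [abs_mul]; exact mul_le_of_le_one_left (abs_nonneg _) hβ
    have := abs_add_le (β * stream β x₀ e k) (e (k + 1))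
    linarith

lemma measurable_stream {Ω : Type*} {m : MeasurableSpace Ω} {X₀ : Ω → ℝ} {ε : ℕ → Ω → ℝ} {k : ℕ}
    (β : ℝ) (hX₀ : Measurable X₀) (hε : ∀ i, 1 ≤ i → i ≤ k → Measurable (ε i)) :
    Measurable fun ω => stream β (X₀ ω) (fun i => ε i ω) k := by
  induction k with
  | zero => exact hX₀
  | succ k ih =>
    exact ((ih fun i h1 h2 => hε i h1 (by omega)).const_mul β).add (hε (k + 1) (by omega) le_rfl)

lemma measurable_weight {Ω : Type*} {m : MeasurableSpace Ω} {x : Ω → ℕ → ℝ} {n : ℕ} (δ c : ℝ)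
    (hx : ∀ i ≤ n, Measurable fun ω => x ω i) :
    Measurable fun ω => weight δ c (x ω) n := by
  unfold weight
  have hsum : Measurable fun ω => ∑ j ∈ Finset.range n, x ω j ^ 2 :=
    Finset.measurable_fun_sum _ fun i hi =>
      (hx i (Finset.mem_range.1 hi).le).pow_const 2
  have h1 : MeasurableSet {ω | ∑ j ∈ Finset.range n, x ω j ^ 2 < c} :=
    measurableSet_lt hsum measurable_const
  have h2 : MeasurableSet {ω | |x ω n| ≤ δ * √c} :=
    measurableSet_le (hx n le_rfl).abs measurable_const
  exact Measurable.ite (h1.inter h2) ((hx n le_rfl).div_const _) measurable_const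

lemma measurable_blockInfo (l t : ℕ) : Measurable fun x : ℕ → ℝ => blockInfo x l t := by
  unfold blockInfo; fun_prop

lemma measurable_stopTime (l : ℕ) (c : ℝ) : Measurable fun x : ℕ → ℝ => stopTime x l c := by
  have hS : ∀ t, MeasurableSet {x : ℕ → ℝ | l ≤ t ∧ c ≤ blockInfo x l t} := fun t =>
    (MeasurableSet.const _).inter (measurableSet_le measurable_const (measurable_blockInfo l t))
  have hpos : ∀ n, n ≠ 0 → MeasurableSet {x : ℕ → ℝ | stopTime x l c = n} := fun n hn => by
    have : {x : ℕ → ℝ | stopTime x l c = n} = {x : ℕ → ℝ | l ≤ n ∧ c ≤ blockInfo x l n} ∩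
        ⋂ t : ℕ, ⋂ (_ : t < n), {x : ℕ → ℝ | l ≤ t ∧ c ≤ blockInfo x l t}ᶜ := by
      ext x
      simp only [Set.mem_inter_iff, Set.mem_iInter]
      exact nat_sInf_eq_iff (p := fun t => l ≤ t ∧ c ≤ blockInfo x l t) hn
    rw [this]
    exact (hS n).inter (MeasurableSet.iInter fun t => MeasurableSet.iInter fun _ => (hS t).compl)
  refine measurable_to_countable' fun n => ?_
  rcases eq_or_ne n 0 with rfl | hn
  -- The default value `0` is treated as the complement of all nonzero values.
  · have : (fun x : ℕ → ℝ => stopTime x l c) ⁻¹' {0}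
        = (⋃ n : ℕ, ⋃ (_ : n ≠ 0), {x : ℕ → ℝ | stopTime x l c = n})ᶜ := by
      ext x
      simp only [Set.mem_preimage, Set.mem_singleton_iff, Set.mem_compl_iff, Set.mem_iUnion]
      exact ⟨fun h ⟨i, hi, hx⟩ => hi (hx.symm.trans h), fun h => by_contra fun h' => h ⟨_, h', rfl⟩⟩
    rw [this]
    exact (MeasurableSet.iUnion fun n => MeasurableSet.iUnion fun hn => hpos n hn).compl
  · exact hpos n hn

lemma measurable_normalizedError (β : ℝ) (l : ℕ) (c : ℝ) :
    Measurable fun x : ℕ → ℝ => normalizedError β x l c := by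
  have h : Measurable fun p : ℕ × (ℕ → ℝ) =>
      √(blockInfo p.2 l p.1) * (lsEstimator p.2 l p.1 - β) := by
    refine measurable_from_prod_countable_right fun t => ?_
    have := measurable_blockInfo l t
    have h2 : Measurable fun x : ℕ → ℝ => ∑ j ∈ Finset.Icc l t, x (j - 1) * x j := by fun_prop
    exact this.sqrt.mul ((h2.div this).sub_const β)
  exact h.comp ((measurable_stopTime l c).prodMk measurable_id)

end Stream

/-! ### Uniform convergence of characteristic functions -/

section Core

lemma norm_exp_mul_I_sub_le (s t : ℝ) :
    ‖Complex.exp (s * Complex.I) - Complex.exp (t * Complex.I)‖ ≤ |s - t| := by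
  have h : Complex.exp (s * Complex.I) - Complex.exp (t * Complex.I)
      = Complex.exp (t * Complex.I) * (Complex.exp (Complex.I * ((s - t : ℝ) : ℂ)) - 1) := by
    rw [mul_sub, ← Complex.exp_add, mul_one]
    congr 2; push_cast; ring
  rw [h, norm_mul, Complex.norm_exp_ofReal_mul_I, one_mul, ← Real.norm_eq_abs]
  exact Real.norm_exp_I_mul_ofReal_sub_one_le

/-- From `1 ≤ √W ≤ W ≤ 1 + d` the factor `1/√W` lies in `[1 - d, 1]`. Replacing `|S|` by `1 + S²`
leaves a bound integrable through the second moment. -/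
lemma abs_div_sqrt_sub_le {S W d : ℝ} (h1 : 1 ≤ W) (h2 : W ≤ 1 + d) :
    |S / √W - S| ≤ d * (1 + S ^ 2) := by
  have hs : 1 ≤ √W := Real.one_le_sqrt.2 h1
  have hsW : √W ≤ W := by nlinarith [Real.mul_self_sqrt (zero_le_one.trans h1)]
  have h3 : 1 - d ≤ 1 / √W := by
    rw [le_div_iff₀ (by linarith)]
    rcases le_or_gt d 1 with hd | hd
    · nlinarith
    · nlinarith
  have h4 : 1 / √W ≤ 1 := by rw [div_le_one (by linarith)]; exact hs
  have hS : |S| ≤ 1 + S ^ 2 := by rw [← sq_abs S]; nlinarith [sq_nonneg (|S| - 1), abs_nonneg S]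
  rw [show S / √W - S = S * (1 / √W - 1) by ring, abs_mul, mul_comm]
  have h5 : |1 / √W - 1| ≤ d := by rw [abs_le]; constructor <;> linarith
  exact mul_le_mul h5 hS (abs_nonneg _) ((abs_nonneg _).trans h5)

variable {Ω : Type*} {m0 : MeasurableSpace Ω} {P : Measure Ω} [IsProbabilityMeasure P]

/-- The compensated exponential equals `exp(iuS) exp(u²(W - 1)/2)`, so the error has two sources:
replacing `S/√W` by `S`, and replacing `W` by `1`. -/
lemma norm_exp_sub_exp_add_le_of_good {u S W Z δ : ℝ} (h1 : 1 ≤ W) (h2 : W ≤ 1 + δ ^ 2)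
    (hZ : Z = S / √W) :
    ‖Complex.exp ((u * Z : ℝ) * Complex.I) - Real.exp (-(u ^ 2 / 2))
        * Complex.exp ((u * S : ℝ) * Complex.I + (u ^ 2 / 2 * W : ℝ))‖
      ≤ |u| * δ ^ 2 * (1 + S ^ 2) + (Real.exp (u ^ 2 / 2 * δ ^ 2) - 1) := by
  have e1 : (Real.exp (-(u ^ 2 / 2)) : ℂ)
        * Complex.exp ((u * S : ℝ) * Complex.I + (u ^ 2 / 2 * W : ℝ))
      = Complex.exp ((u * S : ℝ) * Complex.I) * (Real.exp (u ^ 2 / 2 * (W - 1)) : ℝ) := by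
    rw [Complex.ofReal_exp, Complex.ofReal_exp, ← Complex.exp_add, ← Complex.exp_add]
    congr 1; push_cast; ring
  rw [e1]
  have e2 : Complex.exp ((u * Z : ℝ) * Complex.I)
        - Complex.exp ((u * S : ℝ) * Complex.I) * (Real.exp (u ^ 2 / 2 * (W - 1)) : ℝ)
      = (Complex.exp ((u * Z : ℝ) * Complex.I) - Complex.exp ((u * S : ℝ) * Complex.I))
        - Complex.exp ((u * S : ℝ) * Complex.I)
          * ((Real.exp (u ^ 2 / 2 * (W - 1)) - 1 : ℝ) : ℂ) := by push_cast; ring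
  rw [e2]
  refine (norm_sub_le _ _).trans (add_le_add ?_ ?_)
  · refine (norm_exp_mul_I_sub_le _ _).trans ?_
    rw [← mul_sub, abs_mul, mul_assoc, hZ]
    exact mul_le_mul_of_nonneg_left (abs_div_sqrt_sub_le h1 h2) (abs_nonneg _)
  · rw [norm_mul, Complex.norm_exp_ofReal_mul_I, one_mul, Complex.norm_real, Real.norm_of_nonneg]
    · have : u ^ 2 / 2 * (W - 1) ≤ u ^ 2 / 2 * δ ^ 2 :=
        mul_le_mul_of_nonneg_left (by linarith) (by positivity)
      linarith [Real.exp_le_exp.2 this]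
    · rw [sub_nonneg, Real.one_le_exp_iff]
      exact mul_nonneg (by positivity) (by linarith)

/-- The crude bound for the exceptional event, where `W` may be smaller than `1` and `Z` is
arbitrary. -/
lemma norm_exp_sub_exp_add_le {u S W Z δ : ℝ} (h2 : W ≤ 1 + δ ^ 2) :
    ‖Complex.exp ((u * Z : ℝ) * Complex.I) - Real.exp (-(u ^ 2 / 2))
        * Complex.exp ((u * S : ℝ) * Complex.I + (u ^ 2 / 2 * W : ℝ))‖
      ≤ 1 + Real.exp (u ^ 2 / 2 * δ ^ 2) := by
  refine (norm_sub_le _ _).trans (add_le_add (Complex.norm_exp_ofReal_mul_I _).le ?_)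
  rw [norm_mul, Complex.norm_real, Real.norm_of_nonneg (Real.exp_pos _).le, Complex.exp_add,
    norm_mul, Complex.norm_exp_ofReal_mul_I, one_mul, Complex.norm_exp_ofReal, ← Real.exp_add]
  refine Real.exp_le_exp.2 ?_
  nlinarith [mul_le_mul_of_nonneg_left h2 (show 0 ≤ u ^ 2 / 2 by positivity)]

/-- Uniform version of the martingale central limit argument: on every event of the initial
`σ`-algebra, a variable `Z` that agrees with the self-normalized weighted sum outside of `bad`
has nearly Gaussian characteristic function. -/
lemma norm_setIntegral_exp_sub_gaussian_le {ℱ : Filtration ℕ m0} {ξ a : ℕ → Ω → ℝ}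
    (hξ : ∀ i, Measurable[ℱ (i + 1)] (ξ i))
    (hind : ∀ i, Indep (ℱ i) (MeasurableSpace.comap (ξ i) inferInstance) P)
    {μ : Measure ℝ} (hlaw : ∀ i, P.map (ξ i) = μ)
    (hL2 : ∀ i, MemLp (ξ i) 2 P) (hmean : ∀ i, ∫ ω, ξ i ω ∂P = 0)
    (hvar : ∀ i, ∫ ω, ξ i ω ^ 2 ∂P = 1)
    (ha : ∀ i, Measurable[ℱ i] (a i)) {δ κ u : ℝ} (haδ : ∀ i ω, |a i ω| ≤ δ)
    (haB : ∀ n ω, ∑ i ∈ Finset.range n, a i ω ^ 2 ≤ 1 + δ ^ 2) (hκ : 0 ≤ κ)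
    (hμ : ∀ s : ℝ, |s| ≤ |u| * δ → ‖charFun μ s - Complex.exp (-(s ^ 2 / 2 : ℝ))‖ ≤ κ * s ^ 2)
    {A : Set Ω} (hA : MeasurableSet[ℱ 0] A) (n : ℕ) {Z : Ω → ℝ} (hZ : Measurable Z)
    {bad : Set Ω} (hbad : MeasurableSet bad)
    (hgood : ∀ ω ∉ bad, 1 ≤ ∑ i ∈ Finset.range n, a i ω ^ 2 ∧
      Z ω = (∑ i ∈ Finset.range n, a i ω * ξ i ω) / √(∑ i ∈ Finset.range n, a i ω ^ 2)) :
    ‖∫ ω in A, Complex.exp ((u * Z ω : ℝ) * Complex.I) ∂P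
        - P.real A * Real.exp (-(u ^ 2 / 2))‖
      ≤ |u| * δ ^ 2 * (2 + δ ^ 2) + (Real.exp (u ^ 2 / 2 * δ ^ 2) - 1)
        + (1 + Real.exp (u ^ 2 / 2 * δ ^ 2)) * P.real bad
        + κ * u ^ 2 * (1 + δ ^ 2) * Real.exp (u ^ 2 / 2 * δ ^ 2) := by
  have hA' : MeasurableSet A := ℱ.le 0 _ hA
  have hξ' : ∀ i, Measurable (ξ i) := fun i => (hξ i).mono (ℱ.le _) le_rfl
  have ha' : ∀ i, Measurable (a i) := fun i => (ha i).mono (ℱ.le _) le_rfl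
  have hmain := norm_setIntegral_exp_sub_le hξ hind hlaw ha haδ haB hκ hμ hA n
  obtain ⟨hSint, hSle⟩ := integral_sq_sum_mul_le hξ hind hL2 hmean hvar ha haδ haB n
  set S : Ω → ℝ := fun ω => ∑ i ∈ Finset.range n, a i ω * ξ i ω
  set W : Ω → ℝ := fun ω => ∑ i ∈ Finset.range n, a i ω ^ 2
  have hS : Measurable S := Finset.measurable_fun_sum _ fun i _ => (ha' i).mul (hξ' i)
  have hW : Measurable W := Finset.measurable_fun_sum _ fun i _ => (ha' i).pow_const 2
  set F : Ω → ℂ := fun ω => Complex.exp ((u * S ω : ℝ) * Complex.I + (u ^ 2 / 2 * W ω : ℝ))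
  set q : ℝ := Real.exp (-(u ^ 2 / 2))
  set D : ℝ := Real.exp (u ^ 2 / 2 * δ ^ 2)
  have hD : 1 ≤ D := Real.one_le_exp (by positivity)
  have hq : 0 < q := Real.exp_pos _
  have iZ : Integrable (fun ω => Complex.exp ((u * Z ω : ℝ) * Complex.I)) P :=
    Integrable.of_bound (by fun_prop) 1
      (ae_of_all _ fun ω => (Complex.norm_exp_ofReal_mul_I _).le)
  have iF : Integrable F P := by
    refine Integrable.of_bound (C := Real.exp (u ^ 2 / 2 * (1 + δ ^ 2)))
      (Measurable.aestronglyMeasurable (by fun_prop)) (ae_of_all _ fun ω => ?_)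
    simp only [F]
    rw [Complex.exp_add, norm_mul, Complex.norm_exp_ofReal_mul_I, one_mul, Complex.norm_exp_ofReal]
    exact Real.exp_le_exp.2 (mul_le_mul_of_nonneg_left (haB n ω) (by positivity))
  have hpt : ∀ ω, ‖Complex.exp ((u * Z ω : ℝ) * Complex.I) - q * F ω‖
      ≤ |u| * δ ^ 2 * (1 + S ω ^ 2) + (D - 1) + bad.indicator (fun _ => 1 + D) ω := by
    intro ω
    by_cases hω : ω ∈ bad
    · rw [Set.indicator_of_mem hω]
      have := norm_exp_sub_exp_add_le (u := u) (S := S ω) (Z := Z ω) (haB n ω)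
      have h0 : 0 ≤ |u| * δ ^ 2 * (1 + S ω ^ 2) := by positivity
      linarith
    · rw [Set.indicator_of_notMem hω, add_zero]
      exact norm_exp_sub_exp_add_le_of_good (hgood ω hω).1 (haB n ω) (hgood ω hω).2
  have ibound : Integrable (fun ω => |u| * δ ^ 2 * (1 + S ω ^ 2) + (D - 1)
      + bad.indicator (fun _ => 1 + D) ω) P :=
    ((((integrable_const 1).add hSint).const_mul _).add (integrable_const _)).add
      ((integrable_const _).indicator hbad)
  have hdiff : ‖∫ ω in A, Complex.exp ((u * Z ω : ℝ) * Complex.I) ∂P - q * ∫ ω in A, F ω ∂P‖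
      ≤ |u| * δ ^ 2 * (2 + δ ^ 2) + (D - 1) + (1 + D) * P.real bad := by
    rw [← integral_const_mul, ← integral_sub iZ.integrableOn (iF.const_mul _).integrableOn]
    calc _ ≤ ∫ ω in A, (|u| * δ ^ 2 * (1 + S ω ^ 2) + (D - 1)
          + bad.indicator (fun _ => 1 + D) ω) ∂P :=
          norm_integral_le_of_norm_le ibound.integrableOn (ae_of_all _ hpt)
      _ ≤ ∫ ω, (|u| * δ ^ 2 * (1 + S ω ^ 2) + (D - 1)
          + bad.indicator (fun _ => 1 + D) ω) ∂P :=
          setIntegral_le_integral ibound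
            (ae_of_all _ fun ω => (norm_nonneg _).trans (hpt ω))
      _ = |u| * δ ^ 2 * (1 + ∫ ω, S ω ^ 2 ∂P) + (D - 1) + (1 + D) * P.real bad := by
          have j1 : Integrable (fun ω => |u| * δ ^ 2 * (1 + S ω ^ 2)) P :=
            ((integrable_const 1).add hSint).const_mul _
          have j2 : Integrable (fun ω => |u| * δ ^ 2 * (1 + S ω ^ 2) + (D - 1)) P :=
            j1.add (integrable_const _)
          rw [integral_add j2 ((integrable_const _).indicator hbad),
            integral_add j1 (integrable_const _), integral_const_mul,
            integral_add (integrable_const 1) hSint, integral_indicator hbad]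
          rw [setIntegral_const, integral_const, integral_const, probReal_univ]
          simp only [smul_eq_mul]
          ring
      _ ≤ _ := by
          have : |u| * δ ^ 2 * (1 + ∫ ω, S ω ^ 2 ∂P) ≤ |u| * δ ^ 2 * (2 + δ ^ 2) :=
            mul_le_mul_of_nonneg_left (by linarith) (by positivity)
          linarith
  have hlast : ‖(q : ℂ) * (∫ ω in A, F ω ∂P - P.real A)‖ ≤ κ * u ^ 2 * (1 + δ ^ 2) * D := by
    rw [norm_mul, Complex.norm_real, Real.norm_of_nonneg hq.le]
    calc _ ≤ q * (κ * u ^ 2 * (1 + δ ^ 2) * Real.exp (u ^ 2 / 2 * (1 + δ ^ 2))) :=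
          mul_le_mul_of_nonneg_left hmain hq.le
      _ = κ * u ^ 2 * (1 + δ ^ 2) * (q * Real.exp (u ^ 2 / 2 * (1 + δ ^ 2))) := by ring
      _ = _ := by
          congr 1
          rw [← Real.exp_add]; congr 1; ring
  calc _ = ‖(∫ ω in A, Complex.exp ((u * Z ω : ℝ) * Complex.I) ∂P - q * ∫ ω in A, F ω ∂P)
        + (q : ℂ) * (∫ ω in A, F ω ∂P - P.real A)‖ := by congr 1; ring
    _ ≤ _ := (norm_add_le _ _).trans (add_le_add hdiff hlast)

lemma tendsto_measureReal_sqrt_lt {H : Ω → ℝ} (hH : Measurable H) {η : ℝ} (hη : 0 < η) :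
    Tendsto (fun c : ℝ => P.real {ω | η * √c < H ω}) atTop (𝓝 0) := by
  have h : Tendsto (fun c : ℝ => ∫ ω, {ω | η * √c < H ω}.indicator (fun _ => (1 : ℝ)) ω ∂P)
      atTop (𝓝 (∫ _, (0 : ℝ) ∂P)) := by
    refine tendsto_integral_filter_of_dominated_convergence (fun _ => 1) ?_ ?_
      (integrable_const _) ?_
    · exact Eventually.of_forall fun c =>
        ((integrable_const (1 : ℝ)).indicator (measurableSet_lt measurable_const hH)).1
    · refine Eventually.of_forall fun c => ae_of_all _ fun ω => ?_
      exact (norm_indicator_le_norm_self _ _).trans (by simp)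
    · refine ae_of_all _ fun ω => ?_
      refine tendsto_const_nhds.congr' ?_
      filter_upwards [(Real.tendsto_sqrt_atTop.const_mul_atTop hη).eventually_ge_atTop (H ω)]
        with c hc
      rw [Set.indicator_of_notMem]
      simpa using hc
  simpa [integral_indicator (measurableSet_lt measurable_const hH)] using h

/-- The characteristic function of the normalized error is asymptotically Gaussian, uniformly
over the autoregressive parameter and over all events that precede the block. -/
theorem eventually_norm_setIntegral_exp_normalizedError_sub_le {ℱ : Filtration ℕ m0}
    {X₀ : Ω → ℝ} {ε : ℕ → Ω → ℝ} {l : ℕ} (hl : 1 ≤ l)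
    (hX₀ : Measurable[ℱ 0] X₀) (hε : ∀ i j, 1 ≤ j → j < l + i → Measurable[ℱ i] (ε j))
    (hε' : ∀ i, Measurable (ε i))
    (hind : ∀ i, Indep (ℱ i) (MeasurableSpace.comap (ε (l + i)) inferInstance) P)
    (hpair : Pairwise fun i j => IndepFun (ε (l + i)) (ε (l + j)) P)
    (hid : ∀ i, IdentDistrib (ε (l + i)) (ε l) P P) (hL2 : MemLp (ε l) 2 P)
    (hmean : ∫ ω, ε l ω ∂P = 0) {σ : ℝ} (hσ : 0 < σ) (hvar : ∫ ω, ε l ω ^ 2 ∂P = σ ^ 2)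
    (u : ℝ) {θ : ℝ} (hθ : 0 < θ) :
    ∀ᶠ c : ℝ in atTop, ∀ β : ℝ, |β| ≤ 1 → ∀ A, MeasurableSet[ℱ 0] A →
      ‖∫ ω in A, Complex.exp ((u * (normalizedError β (stream β (X₀ ω) fun i => ε i ω) l c / σ) : ℝ)
          * Complex.I) ∂P - P.real A * Real.exp (-(u ^ 2 / 2))‖ ≤ θ := by
  have hX₀' : Measurable X₀ := hX₀.mono (ℱ.le 0) le_rfl
  set ξ : ℕ → Ω → ℝ := fun i ω => ε (l + i) ω / σ with hξdef
  have hξid : ∀ i, IdentDistrib (ξ i) (fun ω => ε l ω / σ) P P := fun i =>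
    (hid i).comp (u := fun y => y / σ) (by fun_prop)
  have hξ : ∀ i, Measurable[ℱ (i + 1)] (ξ i) := fun i =>
    (hε (i + 1) (l + i) (by omega) (by omega)).div_const σ
  have hξind : ∀ i, Indep (ℱ i) (MeasurableSpace.comap (ξ i) inferInstance) P := fun i => by
    refine indep_of_indep_of_le_right (hind i) ?_
    have : Measurable[MeasurableSpace.comap (ε (l + i)) inferInstance] (ξ i) :=
      (comap_measurable (ε (l + i))).div_const σ
    exact this.comap_le
  have h0 : ∫ ω, ε l ω / σ ∂P = 0 := by rw [integral_div, hmean, zero_div]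
  have h1 : ∫ ω, (ε l ω / σ) ^ 2 ∂P = 1 := by
    simp only [div_pow]
    rw [integral_div, hvar, div_self (by positivity)]
  have hξL2 : ∀ i, MemLp (ξ i) 2 P := fun i => (hξid i).symm.memLp_snd
    (by simpa [div_eq_inv_mul] using hL2.const_mul σ⁻¹)
  have hξmean : ∀ i, ∫ ω, ξ i ω ∂P = 0 := fun i => (hξid i).integral_eq.trans h0
  have hξvar : ∀ i, ∫ ω, ξ i ω ^ 2 ∂P = 1 := fun i =>
    ((hξid i).comp (u := fun y => y ^ 2) (by fun_prop)).integral_eq.trans h1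
  -- choice of the truncation level and of the quality of the Taylor expansion
  have hlim : Tendsto (fun δ : ℝ => |u| * δ ^ 2 * (2 + δ ^ 2) + (Real.exp (u ^ 2 / 2 * δ ^ 2) - 1))
      (𝓝[>] 0) (𝓝 0) := by
    have hcont : Continuous fun δ : ℝ =>
        |u| * δ ^ 2 * (2 + δ ^ 2) + (Real.exp (u ^ 2 / 2 * δ ^ 2) - 1) := by fun_prop
    have := (hcont.tendsto 0).mono_left (nhdsWithin_le_nhds (s := Set.Ioi 0))
    simpa using this
  -- The Taylor error in the final bound is at most `θ/3` once `δ ≤ 1`; the `+ 1` keeps the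
  -- denominator positive at `u = 0`.
  set κ : ℝ := θ / 3 / (u ^ 2 * 2 * Real.exp (u ^ 2 / 2) + 1) with hκdef
  have hκ : 0 < κ := by positivity
  obtain ⟨r, hr, hchar⟩ := exists_norm_charFun_sub_exp_le ((hε' l).div_const σ) h0 h1 hκ
  have hδ1 : ∀ᶠ δ : ℝ in 𝓝[>] 0, δ ≤ 1 :=
    (eventually_le_nhds zero_lt_one).filter_mono nhdsWithin_le_nhds
  have hδ2 : ∀ᶠ δ : ℝ in 𝓝[>] 0, |u| * δ ≤ r := by
    have : Tendsto (fun δ : ℝ => |u| * δ) (𝓝[>] 0) (𝓝 0) := by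
      have := ((continuous_const_mul |u|).tendsto 0).mono_left
        (nhdsWithin_le_nhds (s := Set.Ioi (0 : ℝ)))
      simpa using this
    exact this.eventually_le_const hr
  obtain ⟨δ, ⟨⟨hδlim, hδle⟩, hδr⟩, hδpos⟩ :=
    (((hlim.eventually_le_const (show 0 < θ / 3 by positivity)).and hδ1).and hδ2).and
      self_mem_nhdsWithin |>.exists
  have hδpos : 0 < δ := hδpos
  -- `K` values above `δ√c/2` carry information at least `c`, and `η` below is chosen so that `(K +
  -- 1) η√c = δ√c/2`.
  set K : ℕ := ⌈4 / δ ^ 2⌉₊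
  have hK : 4 / δ ^ 2 ≤ K := Nat.le_ceil _
  set η : ℝ := δ / (2 * (K + 1)) with hη
  have hηpos : 0 < η := by positivity
  -- the exceptional event
  let e : ℕ → Ω → ℝ := fun i => ε (l + i)
  let H : Ω → ℝ := fun ω => |X₀ ω| + ∑ i ∈ Finset.range (l - 1), |ε (i + 1) ω|
  have hH : Measurable H := hX₀'.abs.add (Finset.measurable_fun_sum _ fun i _ => (hε' _).abs)
  -- The expected noise energy after `N c` steps is at least `8c`, twice the `4c` that forces
  -- information `c`.
  let N : ℝ → ℕ := fun c => ⌈8 / σ ^ 2 * c⌉₊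
  let bad : ℝ → Set Ω := fun c => {ω | η * √c < H ω} ∪
    ({ω | ∃ j < N c, η * √c < |e j ω|} ∪ {ω | ∑ i ∈ Finset.range (N c), e i ω ^ 2 < 4 * c})
  have hbadm : ∀ c, MeasurableSet (bad c) := fun c => by
    refine (measurableSet_lt measurable_const hH).union (MeasurableSet.union ?_
      (measurableSet_lt (Finset.measurable_fun_sum _ fun i _ => (hε' _).pow_const 2)
        measurable_const))
    have : {ω | ∃ j < N c, η * √c < |e j ω|} = ⋃ j, ⋃ (_ : j < N c), {ω | η * √c < |e j ω|} := by
      ext ω; simp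
    rw [this]
    exact MeasurableSet.iUnion fun j => MeasurableSet.iUnion fun _ =>
      measurableSet_lt measurable_const (hε' _).abs
  have hbad0 : Tendsto (fun c => P.real (bad c)) atTop (𝓝 0) := by
    have t1 := tendsto_measureReal_sqrt_lt (P := P) hH hηpos
    have t2 := tendsto_measureReal_exists_noise_gt (P := P) (e := e) (fun i => hε' _) hid hL2
      hηpos (show 0 < 8 / σ ^ 2 by positivity)
    have hv0 : ∫ ω, e 0 ω ^ 2 ∂P = σ ^ 2 := hvar
    have t3 := tendsto_measureReal_sum_sq_lt (P := P) (e := e) (fun i => hε' _) hpair hid hL2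
      (by rw [hv0]; positivity)
    rw [hv0] at t3
    have t4 := t1.add (t2.add t3)
    simp only [add_zero] at t4
    refine squeeze_zero (fun c => measureReal_nonneg) (fun c => ?_) t4
    exact (measureReal_union_le _ _).trans (add_le_add le_rfl (measureReal_union_le _ _))
  have hbad1 : ∀ᶠ c in atTop, (1 + Real.exp (u ^ 2 / 2 * δ ^ 2)) * P.real (bad c) ≤ θ / 3 := by
    have := hbad0.const_mul (1 + Real.exp (u ^ 2 / 2 * δ ^ 2))
    rw [mul_zero] at this
    exact this.eventually_le_const (by positivity)
  -- The threshold for `c` is fixed before `β` and `A` appear, since `bad c` involves neither; this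
  -- is the source of uniformity.
  filter_upwards [hbad1, eventually_gt_atTop 0] with c hcbad hc β hβ A hA
  let X : Ω → ℕ → ℝ := fun ω => stream β (X₀ ω) fun i => ε i ω
  let a : ℕ → Ω → ℝ := fun i ω => weight δ c (fun i => X ω (l - 1 + i)) i
  have ha : ∀ i, Measurable[ℱ i] (a i) := fun i => by
    refine measurable_weight δ c fun j hj => ?_
    exact measurable_stream β (hX₀.mono (ℱ.mono (Nat.zero_le i)) le_rfl)
      fun k hk1 hk2 => hε i k hk1 (by omega)
  have hrec : ∀ ω i, X ω (l - 1 + (i + 1)) = β * X ω (l - 1 + i) + e i ω := fun ω i =>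
    stream_succ_of_one_le hl i
  have hZ : Measurable fun ω => normalizedError β (X ω) l c / σ := by
    refine ((measurable_normalizedError β l c).comp (measurable_pi_lambda _ fun k => ?_)).div_const σ
    exact measurable_stream β hX₀' fun i _ _ => hε' i
  have hgood : ∀ ω ∉ bad c, 1 ≤ ∑ i ∈ Finset.range (N c + 1), a i ω ^ 2 ∧
      normalizedError β (X ω) l c / σ = (∑ i ∈ Finset.range (N c + 1), a i ω * ξ i ω)
        / √(∑ i ∈ Finset.range (N c + 1), a i ω ^ 2) := by
    intro ω hω
    simp only [bad, Set.mem_union, not_or] at hω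
    obtain ⟨g1, g2, g3⟩ := hω
    have g1 : H ω ≤ η * √c := not_lt.1 g1
    have g2 : ∀ j < N c, |e j ω| ≤ η * √c := fun j hj => not_lt.1 fun h => g2 ⟨j, hj, h⟩
    have g3 : 4 * c ≤ ∑ i ∈ Finset.range (N c), e i ω ^ 2 := not_lt.1 g3
    have hsc : 0 < √c := Real.sqrt_pos.2 hc
    have hbig : c ≤ ∑ i ∈ Finset.range (N c + 1), X ω (l - 1 + i) ^ 2 := by
      have := sum_sq_noise_le (x := fun i => X ω (l - 1 + i)) (e := fun i => e i ω) hβ (hrec ω) (N c)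
      linarith
    have hsmall : ∀ m ≤ N c, ∑ i ∈ Finset.range m, X ω (l - 1 + i) ^ 2 < c →
        |X ω (l - 1 + m)| ≤ δ * √c := fun m hm hlt => by
      refine abs_le_of_sum_sq_lt (x := fun i => X ω (l - 1 + i)) (e := fun i => e i ω) hβ (hrec ω)
        (r := η * √c) (K := K) (by positivity) g2 ((abs_stream_le hβ _).trans g1) ?_ ?_ hm hlt
      · refine le_of_eq ?_
        rw [hη]; field_simp
      · rw [div_pow, mul_pow, Real.sq_sqrt hc.le]
        have : 4 ≤ K * δ ^ 2 := by rwa [div_le_iff₀ (by positivity)] at hK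
        nlinarith
    obtain ⟨r1, r2⟩ := normalizedError_eq_weight hl hc (hrec ω) hbig hsmall
    refine ⟨r1, ?_⟩
    rw [r2, div_right_comm, Finset.sum_div]
    congr 1
    exact Finset.sum_congr rfl fun i _ => mul_div_assoc _ _ _
  have hfin := norm_setIntegral_exp_sub_gaussian_le hξ hξind (fun i => (hξid i).map_eq) hξL2 hξmean
    hξvar ha (fun i ω => abs_weight_le hδpos.le hc i) (fun n ω => sum_sq_weight_le hδpos.le hc n)
    hκ.le (fun s hs => hchar s (hs.trans hδr)) hA (N c + 1) hZ (hbadm c) hgood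
  refine hfin.trans ?_
  have hδ2le : δ ^ 2 ≤ 1 := pow_le_one₀ hδpos.le hδle
  have hk : κ * u ^ 2 * (1 + δ ^ 2) * Real.exp (u ^ 2 / 2 * δ ^ 2) ≤ θ / 3 := by
    calc _ ≤ κ * u ^ 2 * 2 * Real.exp (u ^ 2 / 2) := by
          gcongr
          · linarith
          · exact mul_le_of_le_one_right (by positivity) hδ2le
      _ = κ * (u ^ 2 * 2 * Real.exp (u ^ 2 / 2)) := by ring
      _ ≤ κ * (u ^ 2 * 2 * Real.exp (u ^ 2 / 2) + 1) := by gcongr; linarith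
      _ = θ / 3 := div_mul_cancel₀ _ (by positivity)
  linarith

end Core

/-! ### The past of the block and the starting event -/

section Independence

variable {Ω : Type*} {m0 : MeasurableSpace Ω} {P : Measure Ω}

/-- The joint law factors as `X ⊗ (Y ⊗ Z)`, and reassociating gives `(X, Y) ⊗ Z`. The lemma stacks
independence assumptions given in layers. -/
lemma indepFun_prodMk_of_indepFun_prodMk [IsProbabilityMeasure P] {α β γ : Type*}
    [MeasurableSpace α] [MeasurableSpace β]
    [MeasurableSpace γ] {X : Ω → α} {Y : Ω → β} {Z : Ω → γ} (hX : Measurable X)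
    (hY : Measurable Y) (hZ : Measurable Z) (h : IndepFun X (fun ω => (Y ω, Z ω)) P)
    (h' : IndepFun Y Z P) : IndepFun (fun ω => (X ω, Y ω)) Z P := by
  have hXY : IndepFun X Y P := h.comp measurable_id measurable_fst
  have : IsProbabilityMeasure (P.map X) := Measure.isProbabilityMeasure_map hX.aemeasurable
  have : IsProbabilityMeasure (P.map Y) := Measure.isProbabilityMeasure_map hY.aemeasurable
  have : IsProbabilityMeasure (P.map Z) := Measure.isProbabilityMeasure_map hZ.aemeasurable
  rw [indepFun_iff_map_prod_eq_prod_map_map (hX.prodMk hY).aemeasurable hZ.aemeasurable]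
  rw [indepFun_iff_map_prod_eq_prod_map_map hX.aemeasurable (hY.prodMk hZ).aemeasurable] at h
  rw [indepFun_iff_map_prod_eq_prod_map_map hY.aemeasurable hZ.aemeasurable] at h'
  rw [indepFun_iff_map_prod_eq_prod_map_map hX.aemeasurable hY.aemeasurable] at hXY
  rw [hXY]
  have e := (measurePreserving_prodAssoc (P.map X) (P.map Y) (P.map Z)).symm
  rw [← e.map_eq, ← h', ← h, Measure.map_map (MeasurableEquiv.measurable _)
    (hX.prodMk (hY.prodMk hZ))]
  rfl

/-- The information available before innovation number `i` of the block: the starting value,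
the earlier innovations and the randomization. -/
noncomputable def past (X₀ : Ω → ℝ) (ε U : ℕ → Ω → ℝ) (l i : ℕ) :
    Ω → (ℝ × (Set.Ico 1 (l + i) → ℝ)) × (ℕ → ℝ) :=
  fun ω => ((X₀ ω, fun j => ε j ω), fun j => U j ω)

variable {X₀ : Ω → ℝ} {ε U : ℕ → Ω → ℝ} {l : ℕ}

lemma measurable_past {m : MeasurableSpace Ω} {i : ℕ} (hX₀ : Measurable X₀)
    (hε : ∀ j, 1 ≤ j → j < l + i → Measurable (ε j)) (hU : ∀ j, Measurable (U j)) :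
    Measurable (past X₀ ε U l i) :=
  (hX₀.prodMk (measurable_pi_lambda _ fun j : Set.Ico 1 (l + i) => hε j j.2.1 j.2.2)).prodMk
    (measurable_pi_lambda _ hU)

lemma measurable_comap_past_start (i : ℕ) :
    Measurable[MeasurableSpace.comap (past X₀ ε U l i) inferInstance] X₀ :=
  (measurable_fst.comp measurable_fst).comp (comap_measurable (past X₀ ε U l i))

lemma measurable_comap_past_noise (i : ℕ) {j : ℕ} (h1 : 1 ≤ j) (h2 : j < l + i) :
    Measurable[MeasurableSpace.comap (past X₀ ε U l i) inferInstance] (ε j) :=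
  ((measurable_pi_apply (⟨j, h1, h2⟩ : Set.Ico 1 (l + i))).comp
    (measurable_snd.comp measurable_fst)).comp (comap_measurable (past X₀ ε U l i))

lemma measurable_comap_past_trial (i j : ℕ) :
    Measurable[MeasurableSpace.comap (past X₀ ε U l i) inferInstance] (U j) :=
  ((measurable_pi_apply j).comp measurable_snd).comp (comap_measurable (past X₀ ε U l i))

/-- The filtration generated by `past`. -/
noncomputable def pastFiltration (hX₀ : Measurable X₀) (hε : ∀ i, Measurable (ε i))
    (hU : ∀ j, Measurable (U j)) (l : ℕ) : Filtration ℕ m0 where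
  seq i := MeasurableSpace.comap (past X₀ ε U l i) inferInstance
  mono' i k hik := by
    exact (measurable_past (measurable_comap_past_start k)
      (fun j h1 h2 => measurable_comap_past_noise k h1 (h2.trans_le (by omega)))
      (measurable_comap_past_trial k)).comap_le
  le' i := (measurable_past hX₀ (fun j _ _ => hε j) hU).comap_le

lemma iIndepFun_shift (hε_indep : iIndepFun (fun i : Set.Ici l => ε i) P) :
    iIndepFun (fun i : ℕ => ε (l + i)) P :=
  hε_indep.precomp (g := fun i : ℕ => (⟨l + i, Nat.le_add_right l i⟩ : Set.Ici l))
    fun _ _ h => Nat.add_left_cancel (congrArg Subtype.val h)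

/-- The past is assembled in layers: earlier block innovations, then the pre-block data, then the
whole randomization sequence. Putting all trials into the initial σ-algebra is harmless because they
are independent of the stream. -/
lemma indepFun_past [IsProbabilityMeasure P] (hl : 1 ≤ l)
    (hX₀ : Measurable X₀) (hε : ∀ i, Measurable (ε i)) (hU : ∀ j, Measurable (U j))
    (hU_stream : IndepFun (fun ω => (X₀ ω, fun i : Set.Ici 1 => ε i ω)) (fun ω j => U j ω) P)
    (hε_indep : iIndepFun (fun i : Set.Ici l => ε i) P)
    (hε_past : IndepFun (fun ω => (X₀ ω, fun i : Set.Ico 1 l => ε i ω))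
      (fun ω (i : Set.Ici l) => ε i ω) P) (i : ℕ) :
    IndepFun (past X₀ ε U l i) (ε (l + i)) P := by
  -- the innovations of the block before number `i`
  let E : Ω → (Finset.range i → ℝ) := fun ω j => ε (l + j) ω
  have hE : Measurable E := by fun_prop
  have h1 : IndepFun E (ε (l + i)) P := by
    have := (iIndepFun_shift hε_indep).indepFun_finset (Finset.range i) {i}
      (by simp) (fun j => hε _)
    exact this.comp measurable_id
      (measurable_pi_apply (⟨i, Finset.mem_singleton_self i⟩ : ({i} : Finset ℕ)))
  have h2 : IndepFun (fun ω => ((X₀ ω, fun j : Set.Ico 1 l => ε j ω), E ω)) (ε (l + i)) P := by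
    refine indepFun_prodMk_of_indepFun_prodMk (by fun_prop) hE (hε _) ?_ h1
    let φ : (Set.Ici l → ℝ) → (Finset.range i → ℝ) × ℝ := fun r =>
      (fun j => r ⟨l + j, Nat.le_add_right _ _⟩, r ⟨l + i, Nat.le_add_right _ _⟩)
    have hφ : Measurable φ := by fun_prop
    exact hε_past.comp measurable_id hφ
  have h3 : IndepFun (fun ω => (X₀ ω, fun j : Set.Ico 1 (l + i) => ε j ω)) (ε (l + i)) P := by
    let ψ : (ℝ × (Set.Ico 1 l → ℝ)) × (Finset.range i → ℝ) → ℝ × (Set.Ico 1 (l + i) → ℝ) :=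
      fun p => (p.1.1, fun j => if h : (j : ℕ) < l then p.1.2 ⟨j, j.2.1, h⟩ else
        p.2 ⟨j - l, Finset.mem_range.2 (by have := j.2.2; omega)⟩)
    have hψ : Measurable ψ := by
      refine (measurable_fst.comp measurable_fst).prodMk (measurable_pi_lambda _ fun j => ?_)
      by_cases h : (j : ℕ) < l
      · simp only [h, dite_true]; fun_prop
      · simp only [h, dite_false]; fun_prop
    have := h2.comp hψ measurable_id
    have heq : (fun ω => (X₀ ω, fun j : Set.Ico 1 (l + i) => ε j ω))
        = ψ ∘ fun ω => ((X₀ ω, fun j : Set.Ico 1 l => ε j ω), E ω) := by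
      funext ω
      refine Prod.ext rfl (funext fun j => ?_)
      by_cases h : (j : ℕ) < l
      · simp [ψ, h]
      · simp only [ψ, E, Function.comp, h, dite_false]
        rw [Nat.add_sub_cancel' (not_lt.1 h)]
    rw [heq]
    exact this
  let χ : ℝ × (Set.Ici 1 → ℝ) → (ℝ × (Set.Ico 1 (l + i) → ℝ)) × ℝ := fun p =>
    ((p.1, fun j => p.2 ⟨j, j.2.1⟩), p.2 ⟨l + i, by simp only [Set.mem_Ici]; omega⟩)
  have hχ : Measurable χ := by fun_prop
  have h4 : IndepFun (fun ω j => U j ω)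
      (fun ω => ((X₀ ω, fun j : Set.Ico 1 (l + i) => ε j ω), ε (l + i) ω)) P :=
    hU_stream.symm.comp measurable_id hχ
  have h5 := indepFun_prodMk_of_indepFun_prodMk (by fun_prop) (by fun_prop) (hε _) h4 h3
  exact h5.comp measurable_swap measurable_id

end Independence

/-! ### Measurability of the starting event and continuity of its probability in `β`. -/

section StartEvent

lemma measurable_of_continuousAt_ne {n₀ : ℕ} {Omg : (Fin n₀ → ℝ) → ℝ}
    (h : ∀ v, v ≠ 0 → ContinuousAt Omg v) : Measurable Omg := by
  refine measurable_of_isOpen fun t ht => ?_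
  rw [← Set.inter_union_compl (Omg ⁻¹' t) {0}]
  refine MeasurableSet.union (Set.Subsingleton.measurableSet
    (Set.subsingleton_singleton.anti Set.inter_subset_right)) (IsOpen.measurableSet ?_)
  rw [isOpen_iff_mem_nhds]
  rintro v ⟨hv1, hv2⟩
  exact inter_mem ((h v hv2).preimage_mem_nhds (ht.mem_nhds hv1)) (isOpen_compl_singleton.mem_nhds hv2)

variable {n₀ : ℕ} {Omg : (Fin n₀ → ℝ) → ℝ}

lemma startTime_eq_iff {x u : ℕ → ℝ} {l : ℕ} (hl : n₀ + 1 ≤ l) :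
    startTime Omg x u = l ↔ Success Omg x u l ∧
      ∀ j < l, ¬ (n₀ + 1 ≤ j ∧ Success Omg x u j) := by
  rw [startTime, nat_sInf_eq_iff (p := fun j => n₀ + 1 ≤ j ∧ Success Omg x u j) (by omega)]
  simp [hl]

lemma measurable_leverage {Ω : Type*} {m : MeasurableSpace Ω} {X₀ : Ω → ℝ} {ε : ℕ → Ω → ℝ}
    {k j : ℕ} (β : ℝ) (hOmg : Measurable Omg) (hX₀ : Measurable X₀)
    (hε : ∀ i, 1 ≤ i → i ≤ k → Measurable (ε i)) (hn : n₀ ≤ k + 1) (hj : j ≤ k + 1) :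
    Measurable fun ω => leverage Omg (stream β (X₀ ω) fun i => ε i ω) j := by
  have h : ∀ i ≤ k, Measurable fun ω => stream β (X₀ ω) (fun i => ε i ω) i := fun i hi =>
    measurable_stream β hX₀ fun i' h1 h2 => hε i' h1 (by omega)
  have hp : Measurable fun ω => pilot n₀ (stream β (X₀ ω) fun i => ε i ω) :=
    measurable_pi_lambda _ fun i => h i (by omega)
  exact ((h (j - 1) (by omega)).mul (hOmg.comp hp)).mul (h (j - 1) (by omega))

/-- Only innovations before `l` enter, and the σ-algebra is arbitrary, so the statement applies to
the initial σ-algebra of the block. -/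
lemma measurableSet_startTime_eq {Ω : Type*} {m : MeasurableSpace Ω} {X₀ : Ω → ℝ}
    {ε U : ℕ → Ω → ℝ} {l : ℕ} (β : ℝ) (hl : n₀ + 1 ≤ l) (hOmg : Measurable Omg)
    (hX₀ : Measurable X₀) (hε : ∀ i, 1 ≤ i → i < l → Measurable (ε i))
    (hU : ∀ j, Measurable (U j)) :
    MeasurableSet {ω | startTime Omg (stream β (X₀ ω) fun i => ε i ω) (fun j => U j ω) = l} := by
  have hS : ∀ j ≤ l, MeasurableSet
      {ω | Success Omg (stream β (X₀ ω) fun i => ε i ω) (fun j => U j ω) j} := fun j hj =>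
    measurableSet_lt (hU j) ((measurable_leverage (k := l - 1) β hOmg hX₀
      (fun i h1 h2 => hε i h1 (by omega)) (by omega) (by omega)).min measurable_const)
  have : {ω | startTime Omg (stream β (X₀ ω) fun i => ε i ω) (fun j => U j ω) = l}
      = {ω | Success Omg (stream β (X₀ ω) fun i => ε i ω) (fun j => U j ω) l} ∩
        ⋂ j : ℕ, ⋂ (_ : j < l ∧ n₀ + 1 ≤ j),
          {ω | Success Omg (stream β (X₀ ω) fun i => ε i ω) (fun j => U j ω) j}ᶜ := by
    ext ω
    simp only [Set.mem_inter_iff, Set.mem_iInter, Set.mem_compl_iff]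
    refine (startTime_eq_iff hl).trans (and_congr Iff.rfl ?_)
    exact ⟨fun h j hj hs => h j hj.1 ⟨hj.2, hs⟩, fun h j hj hs => h j ⟨hj, hs.1⟩ hs.2⟩
  rw [this]
  exact (hS l le_rfl).inter (MeasurableSet.iInter fun j => MeasurableSet.iInter fun hj =>
    (hS j hj.1.le).compl)

lemma continuous_stream (x₀ : ℝ) (e : ℕ → ℝ) (k : ℕ) : Continuous fun β => stream β x₀ e k := by
  induction k with
  | zero => exact continuous_const
  | succ k ih => exact (continuous_id.mul ih).add continuous_const

/-- Zero pilot data force the starting value and the pilot innovations to vanish, whatever `β` is.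
Varying `β` therefore never crosses the possible discontinuity of the precision estimator at `0`. -/
lemma pilot_eq_zero {β β' x₀ : ℝ} {e : ℕ → ℝ} (h : pilot n₀ (stream β x₀ e) = 0) :
    pilot n₀ (stream β' x₀ e) = 0 := by
  have h0 : ∀ k < n₀, stream β x₀ e k = 0 := fun k hk => congrFun h ⟨k, hk⟩
  have h1 : ∀ k < n₀, stream β' x₀ e k = 0 := by
    intro k
    induction k with
    | zero => exact h0 0
    | succ k ih =>
      intro hk
      have a := h0 (k + 1) hk
      rw [stream, h0 k (by omega), mul_zero, zero_add] at a
      rw [stream, ih (by omega), a, mul_zero, zero_add]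
  exact funext fun i => h1 i i.2

/-- The leverage score depends continuously on the autoregressive parameter, also where the
precision estimator is discontinuous. -/
lemma continuous_leverage (hOmg : ∀ v, v ≠ 0 → ContinuousAt Omg v) (x₀ : ℝ) (e : ℕ → ℝ) (j : ℕ) :
    Continuous fun β => leverage Omg (stream β x₀ e) j := by
  have hp : Continuous fun β => pilot n₀ (stream β x₀ e) :=
    continuous_pi fun k => continuous_stream x₀ e k
  have hO : Continuous fun β => Omg (pilot n₀ (stream β x₀ e)) := by
    by_cases h : pilot n₀ (stream 0 x₀ e) = 0
    · have : ∀ β, pilot n₀ (stream β x₀ e) = 0 := fun β => pilot_eq_zero h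
      simp only [this]
      exact continuous_const
    · refine continuous_iff_continuousAt.2 fun β => ?_
      exact ContinuousAt.comp (hOmg _ fun h' => h (pilot_eq_zero h')) hp.continuousAt
  exact ((continuous_stream x₀ e _).mul hO).mul (continuous_stream x₀ e _)

variable {Ω : Type*} {m0 : MeasurableSpace Ω} {P : Measure Ω} [IsProbabilityMeasure P]

lemma ae_ne_of_indepFun {f g : Ω → ℝ} (hf : Measurable f) (hg : Measurable g)
    (h : IndepFun f g P) (hna : ∀ y, P.map g {y} = 0) : ∀ᵐ ω ∂P, g ω ≠ f ω := by
  have : IsProbabilityMeasure (P.map f) := Measure.isProbabilityMeasure_map hf.aemeasurable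
  have : IsProbabilityMeasure (P.map g) := Measure.isProbabilityMeasure_map hg.aemeasurable
  have hD : MeasurableSet {p : ℝ × ℝ | p.2 = p.1} := measurableSet_eq_fun measurable_snd measurable_fst
  have h1 := (indepFun_iff_map_prod_eq_prod_map_map hf.aemeasurable hg.aemeasurable).1 h
  have h2 : P.map (fun ω => (f ω, g ω)) {p : ℝ × ℝ | p.2 = p.1} = 0 := by
    rw [h1, Measure.measure_prod_null hD]
    exact ae_of_all _ fun y => hna y
  rw [Measure.map_apply (hf.prodMk hg) hD] at h2
  exact measure_eq_zero_iff_ae_notMem.1 h2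

/-- The probability of starting at time `l` is a continuous function of the autoregressive
parameter. -/
lemma continuous_measureReal_startTime_eq {X₀ : Ω → ℝ} {ε U : ℕ → Ω → ℝ} {l : ℕ}
    (hl : n₀ + 1 ≤ l) (hX₀ : Measurable X₀) (hε : ∀ i, Measurable (ε i))
    (hU : ∀ j, Measurable (U j)) (hOmg : ∀ v, v ≠ 0 → ContinuousAt Omg v)
    (hU_unif : ∀ j, P.map (U j) = volume.restrict (Set.Icc (0 : ℝ) 1))
    (hU_stream : IndepFun (fun ω => (X₀ ω, fun i : Set.Ici 1 => ε i ω)) (fun ω j => U j ω) P) :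
    Continuous fun β => P.real
      {ω | startTime Omg (stream β (X₀ ω) fun i => ε i ω) (fun j => U j ω) = l} := by
  have hOm := measurable_of_continuousAt_ne hOmg
  let A : ℝ → Set Ω := fun β =>
    {ω | startTime Omg (stream β (X₀ ω) fun i => ε i ω) (fun j => U j ω) = l}
  have hA : ∀ β, MeasurableSet (A β) := fun β =>
    measurableSet_startTime_eq β hl hOm hX₀ (fun i _ _ => hε i) hU
  refine continuous_iff_continuousAt.2 fun β₀ => ?_
  -- A trial can change its outcome under an infinitesimal change of `β` only at a tie with its
  -- threshold; ties are null because `U j` is atomless and independent of the stream.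
  have hne : ∀ᵐ ω ∂P, ∀ j,
      U j ω ≠ min (leverage Omg (stream β₀ (X₀ ω) fun i => ε i ω) j) 1 := by
    refine ae_all_iff.2 fun j => ?_
    let g : Ω → ℝ × (Set.Ici 1 → ℝ) := fun ω => (X₀ ω, fun i => ε i ω)
    have hlev : Measurable[MeasurableSpace.comap g inferInstance] fun ω =>
        min (leverage Omg (stream β₀ (X₀ ω) fun i => ε i ω) j) 1 := by
      refine Measurable.min (measurable_leverage (k := n₀ + j) β₀ hOm
        (measurable_fst.comp (comap_measurable g)) (fun i h1 _ => ?_) (by omega) (by omega))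
        measurable_const
      exact ((measurable_pi_apply (⟨i, h1⟩ : Set.Ici 1)).comp measurable_snd).comp
        (comap_measurable g)
    have hg : Measurable g := by fun_prop
    refine ae_ne_of_indepFun (hlev.mono hg.comap_le le_rfl) (hU j) ?_ fun y => ?_
    · have : IndepFun g (U j) P := hU_stream.comp measurable_id (measurable_pi_apply j)
      exact indepFun_of_indep_comap ((IndepFun_iff_Indep _ _ _).1 this) hlev
    · rw [hU_unif]; simp
  have h1 : ∀ β, P.real (A β) = ∫ ω, (A β).indicator (fun _ => (1 : ℝ)) ω ∂P := fun β => by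
    rw [integral_indicator (hA β)]; simp
  change Tendsto (fun β => P.real (A β)) (𝓝 β₀) (𝓝 (P.real (A β₀)))
  simp only [h1]
  refine tendsto_integral_filter_of_dominated_convergence (fun _ => 1) ?_ ?_
    (integrable_const _) ?_
  · exact Eventually.of_forall fun β => ((integrable_const (1 : ℝ)).indicator (hA β)).1
  · refine Eventually.of_forall fun β => ae_of_all _ fun ω => ?_
    exact (norm_indicator_le_norm_self _ _).trans (by simp)
  · filter_upwards [hne] with ω hω
    have hev : ∀ j, ∀ᶠ β in 𝓝 β₀,
        (Success Omg (stream β (X₀ ω) fun i => ε i ω) (fun j => U j ω) j ↔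
          Success Omg (stream β₀ (X₀ ω) fun i => ε i ω) (fun j => U j ω) j) := fun j => by
      have hc : ContinuousAt (fun β => min (leverage Omg (stream β (X₀ ω) fun i => ε i ω) j) 1) β₀ :=
        ((continuous_leverage hOmg _ _ j).min continuous_const).continuousAt
      rcases lt_or_gt_of_ne (hω j) with h | h
      · filter_upwards [hc.eventually_const_lt h] with β hβ
        exact iff_of_true hβ h
      · filter_upwards [hc.eventually_lt_const h] with β hβ
        exact iff_of_false (not_lt.2 hβ.le) (not_lt.2 h.le)
    -- Only finitely many trials decide whether the start is at `l`, so one neighbourhood of `β₀`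
    -- serves them all.
    have hall : ∀ᶠ β in 𝓝 β₀, ∀ j ∈ Finset.range (l + 1),
        (Success Omg (stream β (X₀ ω) fun i => ε i ω) (fun j => U j ω) j ↔
          Success Omg (stream β₀ (X₀ ω) fun i => ε i ω) (fun j => U j ω) j) :=
      (Filter.eventually_all_finset _).2 fun j _ => hev j
    refine tendsto_const_nhds.congr' ?_
    filter_upwards [hall] with β hβ
    have hiff : ω ∈ A β ↔ ω ∈ A β₀ := by
      refine (startTime_eq_iff hl).trans (Iff.trans ?_ (startTime_eq_iff hl).symm)
      refine and_congr (hβ l (by simp)) (forall_congr' fun j => forall_congr' fun hj => ?_)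
      rw [hβ j (Finset.mem_range.2 (by omega))]
    by_cases h : ω ∈ A β₀
    · rw [Set.indicator_of_mem h, Set.indicator_of_mem (hiff.2 h)]
    · rw [Set.indicator_of_notMem h, Set.indicator_of_notMem (fun h' => h (hiff.1 h'))]

end StartEvent

/-! ### From characteristic functions to uniform convergence of distribution functions -/

section Polya

lemma continuous_cdf (μ : Measure ℝ) [IsProbabilityMeasure μ] [NullSingletonClass μ] :
    Continuous (cdf μ) := by
  refine continuous_iff_continuousAt.2 fun x => ?_
  rw [(monotone_cdf μ).continuousAt_iff_leftLim_eq_rightLim, StieltjesFunction.rightLim_eq]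
  have h := (cdf μ).measure_singleton x
  rw [measure_cdf, measure_singleton] at h
  have h1 := ENNReal.ofReal_eq_zero.1 h.symm
  exact le_antisymm ((monotone_cdf μ).leftLim_le le_rfl) (by linarith)

/-- Weak convergence to a continuous distribution is uniform on the level of distribution
functions. -/
lemma eventually_forall_abs_cdf_sub_le {ι : Type*} {L : Filter ι} {ν : ι → ProbabilityMeasure ℝ}
    {μ : ProbabilityMeasure ℝ} [NullSingletonClass (μ : Measure ℝ)] (h : Tendsto ν L (𝓝 μ)) {θ : ℝ}
    (hθ : 0 < θ) :
    ∀ᶠ k in L, ∀ x, |cdf (ν k : Measure ℝ) x - cdf (μ : Measure ℝ) x| ≤ θ := by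
  set F := cdf (μ : Measure ℝ) with hF
  have hpt : ∀ x, Tendsto (fun k => cdf (ν k : Measure ℝ) x) L (𝓝 (F x)) := fun x => by
    have h1 := ProbabilityMeasure.tendsto_measure_of_null_frontier_of_tendsto' h (E := Set.Iic x)
      (by rw [frontier_Iic]; exact measure_singleton x)
    have h2 := (ENNReal.tendsto_toReal (measure_ne_top (μ : Measure ℝ) (Set.Iic x))).comp h1
    simp only [hF, cdf_eq_real]
    exact h2
  obtain ⟨M, hM⟩ := exists_nat_gt (2 / θ)
  have hM0 : (0 : ℝ) < M := lt_trans (by positivity) hM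
  have hMθ : 1 / (M : ℝ) ≤ θ / 2 := by
    rw [div_lt_iff₀ hθ] at hM
    rw [div_le_iff₀ hM0]; linarith
  -- Quantiles at spacing `1/M ≤ θ/2`: half of `θ` pays for the grid, half for convergence on it.
  -- The levels `0` and `1` need not be attained; there the bounds `0 ≤ cdf ≤ 1` suffice.
  have hq : ∀ j : ℕ, 0 < j → j < M → ∃ y, F y = j / M := fun j h0 h1 => by
    have j0 : (0 : ℝ) < j / M := by positivity
    have j1 : (j / M : ℝ) < 1 := by rw [div_lt_one hM0]; exact_mod_cast h1
    refine mem_range_of_exists_le_of_exists_ge (continuous_cdf _) ?_ ?_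
    · exact ((tendsto_cdf_atBot (μ : Measure ℝ)).eventually_le_const j0).exists
    · exact ((tendsto_cdf_atTop (μ : Measure ℝ)).eventually_const_le j1).exists
  choose! y hy using hq
  have hall : ∀ᶠ k in L, ∀ j ∈ Finset.range M, |cdf (ν k : Measure ℝ) (y j) - F (y j)| ≤ θ / 2 := by
    refine (Filter.eventually_all_finset _).2 fun j _ => ?_
    have := ((hpt (y j)).sub_const (F (y j))).abs
    rw [sub_self, abs_zero] at this
    exact this.eventually_le_const (half_pos hθ)
  filter_upwards [hall] with k hk x
  have hF0 : 0 ≤ F x := cdf_nonneg _ x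
  rw [abs_le]
  constructor
  · -- the largest grid value strictly below `F x`
    by_cases hx : F x = 0
    · linarith [cdf_nonneg (ν k : Measure ℝ) x]
    have hFpos : 0 < F x := lt_of_le_of_ne hF0 (Ne.symm hx)
    have hc1 := Nat.le_ceil (M * F x)
    have hc2 := Nat.ceil_lt_add_one (a := M * F x) (by positivity)
    have hc3 : 0 < ⌈M * F x⌉₊ := Nat.ceil_pos.2 (by positivity)
    obtain ⟨j, hj⟩ : ∃ j, ⌈M * F x⌉₊ = j + 1 := ⟨_, (Nat.succ_pred_eq_of_pos hc3).symm⟩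
    rw [hj] at hc1 hc2
    push_cast at hc1 hc2
    have b1 : F x ≤ j / M + 1 / M := by
      rw [← add_div, le_div_iff₀ hM0]; linarith
    have b2 : (j / M : ℝ) < F x := by rw [div_lt_iff₀ hM0]; linarith
    rcases Nat.eq_zero_or_pos j with rfl | hj0
    · have := cdf_nonneg (ν k : Measure ℝ) x
      simp only [Nat.cast_zero, zero_div, zero_add] at b1
      linarith
    · have hjM : j < M := by
        have : (j / M : ℝ) < 1 := b2.trans_le (cdf_le_one _ x)
        rw [div_lt_one hM0] at this
        exact_mod_cast this
      have hyx : y j ≤ x := by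
        by_contra! hlt
        have := monotone_cdf (μ : Measure ℝ) hlt.le
        rw [← hF, hy j hj0 hjM] at this
        linarith
      have h1 := monotone_cdf (ν k : Measure ℝ) hyx
      have h2 := (abs_le.1 (hk j (Finset.mem_range.2 hjM))).1
      rw [hy j hj0 hjM] at h2
      linarith
  · -- the smallest grid value strictly above `F x`
    have hc1 := Nat.floor_le (a := M * F x) (by positivity)
    have hc2 := Nat.lt_floor_add_one (M * F x)
    set j := ⌊M * F x⌋₊ + 1 with hj
    have b1 : (j / M : ℝ) ≤ F x + 1 / M := by
      rw [← sub_le_iff_le_add, ← sub_div, div_le_iff₀ hM0, hj]; push_cast; linarith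
    have b2 : F x < j / M := by
      rw [lt_div_iff₀ hM0, hj]; push_cast; linarith
    rcases lt_or_ge j M with hjM | hjM
    · have hj0 : 0 < j := Nat.succ_pos _
      have hxy : x ≤ y j := by
        by_contra! hlt
        have := monotone_cdf (μ : Measure ℝ) hlt.le
        rw [← hF, hy j hj0 hjM] at this
        linarith
      have h1 := monotone_cdf (ν k : Measure ℝ) hxy
      have h2 := (abs_le.1 (hk j (Finset.mem_range.2 hjM))).2
      rw [hy j hj0 hjM] at h2
      linarith
    · have : (1 : ℝ) ≤ j / M := by
        rw [one_le_div hM0]; exact_mod_cast hjM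
      linarith [cdf_le_one (ν k : Measure ℝ) x]

end Polya

/-! ### Normal approximation under the conditional laws. -/

section Conditional

variable {Ω : Type*} {m0 : MeasurableSpace Ω} {P : Measure Ω}

lemma integral_cond {A : Set Ω} (f : Ω → ℂ) :
    ∫ ω, f ω ∂(ProbabilityTheory.cond P A) = (P.real A)⁻¹ • ∫ ω in A, f ω ∂P := by
  rw [ProbabilityTheory.cond, integral_smul_measure, ENNReal.toReal_inv]
  rfl

variable [IsProbabilityMeasure P]

/-- If, on a family of events with probabilities bounded below, the characteristic functions of
`Z` are uniformly asymptotically Gaussian, then so are the conditional distribution functions. -/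
lemma eventually_forall_abs_cond_sub_cdf_le {T : Type*} {A : T → Set Ω} {d : ℝ} (hd : 0 < d) (hAd : ∀ b, d ≤ P.real (A b)) {Z : ℝ → T → Ω → ℝ}
    (hZ : ∀ c b, Measurable (Z c b))
    (h : ∀ u θ : ℝ, 0 < θ → ∀ᶠ c in atTop, ∀ b,
      ‖∫ ω in A b, Complex.exp ((u * Z c b ω : ℝ) * Complex.I) ∂P
        - P.real (A b) * Real.exp (-(u ^ 2 / 2))‖ ≤ θ) {θ : ℝ} (hθ : 0 < θ) :
    ∀ᶠ c in atTop, ∀ b, ∀ x, |(ProbabilityTheory.cond P (A b)).real {ω | Z c b ω ≤ x}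
      - cdf (gaussianReal 0 1) x| ≤ θ := by
  by_contra hcon
  rw [not_eventually] at hcon
  -- A failure of uniformity yields a single sequence of laws, with parameters varying along it, to
  -- which Lévy's continuity theorem applies.
  have hseq : ∀ k : ℕ, ∃ c : ℝ, (k : ℝ) ≤ c ∧ ∃ b, ∃ x,
      θ < |(ProbabilityTheory.cond P (A b)).real {ω | Z c b ω ≤ x}
        - cdf (gaussianReal 0 1) x| := fun k => by
    obtain ⟨c, hc, hkc⟩ := (hcon.and_eventually (eventually_ge_atTop (k : ℝ))).exists
    push Not at hc
    exact ⟨c, hkc, hc⟩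
  choose c hc b x hx using hseq
  have hclim : Tendsto c atTop atTop := tendsto_atTop_mono hc tendsto_natCast_atTop_atTop
  have hpos : ∀ b, 0 < P.real (A b) := fun b => hd.trans_le (hAd b)
  have hprob : ∀ b, IsProbabilityMeasure (ProbabilityTheory.cond P (A b)) := fun b =>
    cond_isProbabilityMeasure fun h0 => by
      have := hpos b
      rw [Measure.real, h0] at this
      simp at this
  let ν : ℕ → ProbabilityMeasure ℝ := fun k =>
    ⟨(ProbabilityTheory.cond P (A (b k))).map (Z (c k) (b k)),
      Measure.isProbabilityMeasure_map (hZ _ _).aemeasurable⟩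
  let μ : ProbabilityMeasure ℝ := ⟨gaussianReal 0 1, inferInstance⟩
  have : NullSingletonClass (μ : Measure ℝ) := nullSingletonClass_gaussianReal one_ne_zero
  have hν : Tendsto ν atTop (𝓝 μ) := by
    refine ProbabilityMeasure.tendsto_of_tendsto_charFun fun u => ?_
    rw [Metric.tendsto_nhds]
    intro θ' hθ'
    -- The factor `d` compensates the division by the probability of the conditioning event.
    filter_upwards [hclim.eventually (h u (d * (θ' / 2)) (by positivity))] with k hk
    have hk := hk (b k)
    have e1 : charFun (ν k : Measure ℝ) u = (P.real (A (b k)))⁻¹ •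
        ∫ ω in A (b k), Complex.exp ((u * Z (c k) (b k) ω : ℝ) * Complex.I) ∂P := by
      change charFun ((ProbabilityTheory.cond P (A (b k))).map (Z (c k) (b k))) u = _
      rw [charFun_apply_real, integral_map (hZ _ _).aemeasurable
        (Measurable.aestronglyMeasurable (by fun_prop)), integral_cond]
      simp
    have e2 : charFun (μ : Measure ℝ) u = Real.exp (-(u ^ 2 / 2)) := by
      change charFun (gaussianReal 0 1) u = _
      rw [charFun_gaussianReal]
      push_cast
      congr 1
      simp
    have hp := hpos (b k)
    have hp' : (P.real (A (b k)) : ℂ) ≠ 0 := by exact_mod_cast hp.ne'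
    rw [dist_eq_norm, e1, e2]
    have e3 : (P.real (A (b k)))⁻¹ •
          ∫ ω in A (b k), Complex.exp ((u * Z (c k) (b k) ω : ℝ) * Complex.I) ∂P
          - (Real.exp (-(u ^ 2 / 2)) : ℂ)
        = (P.real (A (b k)))⁻¹ •
          (∫ ω in A (b k), Complex.exp ((u * Z (c k) (b k) ω : ℝ) * Complex.I) ∂P
          - P.real (A (b k)) * Real.exp (-(u ^ 2 / 2))) := by
      rw [smul_sub, Complex.real_smul, Complex.real_smul, Complex.ofReal_inv,
        inv_mul_cancel_left₀ hp']
    rw [e3, norm_smul, norm_inv, Real.norm_of_nonneg hp.le]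
    calc _ ≤ (P.real (A (b k)))⁻¹ * (d * (θ' / 2)) := by gcongr
      _ ≤ d⁻¹ * (d * (θ' / 2)) := by
          gcongr
          exact hAd _
      _ = θ' / 2 := inv_mul_cancel_left₀ hd.ne' _
      _ < θ' := half_lt_self hθ'
  obtain ⟨k, hk⟩ := (eventually_forall_abs_cdf_sub_le hν hθ).exists
  have hk := hk (x k)
  have e : cdf (ν k : Measure ℝ) (x k)
      = (ProbabilityTheory.cond P (A (b k))).real {ω | Z (c k) (b k) ω ≤ x k} := by
    rw [cdf_eq_real]
    exact map_measureReal_apply (hZ _ _) measurableSet_Iic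
  rw [e] at hk
  exact absurd hk (not_le.2 (hx k))

end Conditional

end SLS

/-! ### Assembly of the main theorem. -/

theorem mainTheorem1 {Ω : Type*} [MeasurableSpace Ω] (P : Measure Ω) [IsProbabilityMeasure P]
    -- starting value, innovations, and the randomization of the Bernoulli trials
    (X₀ : Ω → ℝ) (ε U : ℕ → Ω → ℝ)
    (hX₀ : Measurable X₀) (hε : ∀ i, Measurable (ε i)) (hU : ∀ j, Measurable (U j))
    -- pilot sample size, precision estimator computed from the pilot data, starting time
    (n₀ : ℕ) (Omg : (Fin n₀ → ℝ) → ℝ) (hOmg_nonneg : ∀ v, 0 ≤ Omg v)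
    (hOmg_cont : ∀ v, v ≠ 0 → ContinuousAt Omg v)
    (l : ℕ) (hl : n₀ + 1 ≤ l)
    -- the trials are driven by i.i.d. uniform variables independent of the stream
    (hU_unif : ∀ j, P.map (U j) = volume.restrict (Set.Icc (0 : ℝ) 1))
    (hU_indep : iIndepFun U P)
    (hU_stream : IndepFun (fun ω => (X₀ ω, fun i : Set.Ici 1 => ε i ω)) (fun ω j => U j ω) P)
    -- innovations from time `l` on: i.i.d., mean `0`, variance `σ²`, independent of the past
    (σ : ℝ) (hσ : 0 < σ)
    (hε_indep : iIndepFun (fun i : Set.Ici l => ε i) P)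
    (hε_ident : ∀ i, l ≤ i → IdentDistrib (ε i) (ε l) P P)
    (hε_L2 : MemLp (ε l) 2 P) (hε_mean : ∫ ω, ε l ω ∂P = 0)
    (hε_var : ProbabilityTheory.variance (ε l) P = σ ^ 2)
    (hε_past : IndepFun (fun ω => (X₀ ω, fun i : Set.Ico 1 l => ε i ω))
      (fun ω (i : Set.Ici l) => ε i ω) P)
    -- `l` is a possible starting time, so that the conditional measures are defined
    (hstart : ∀ β ∈ Set.Icc (-1 : ℝ) 1,
      0 < P {ω | SLS.startTime Omg (SLS.stream β (X₀ ω) (fun i => ε i ω)) (fun j => U j ω) = l}) :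
    -- the stopping time is almost surely finite
    (∀ β ∈ Set.Icc (-1 : ℝ) 1, ∀ c : ℝ, ∀ᵐ ω ∂(SLS.condLaw P X₀ ε U Omg l β),
      ∃ t, l ≤ t ∧ c ≤ SLS.blockInfo (SLS.stream β (X₀ ω) (fun i => ε i ω)) l t) ∧
    -- uniform asymptotic normality
    Tendsto (fun c : ℝ => ⨆ β : Set.Icc (-1 : ℝ) 1, ⨆ x : ℝ,
        |(SLS.condLaw P X₀ ε U Omg l β).real
            {ω | SLS.normalizedError β (SLS.stream β (X₀ ω) (fun i => ε i ω)) l c ≤ x}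
          - cdf (gaussianReal 0 1) (x / σ)|)
      atTop (𝓝 0) := by
  have hl1 : 1 ≤ l := by omega
  have hsq : ∫ ω, ε l ω ^ 2 ∂P = σ ^ 2 := by
    rw [← hε_var, variance_of_integral_eq_zero (hε l).aemeasurable hε_mean]
  have hpair : Pairwise fun i j => IndepFun (ε (l + i)) (ε (l + j)) P := fun i j hij =>
    (SLS.iIndepFun_shift hε_indep).indepFun hij
  have hid : ∀ i, IdentDistrib (ε (l + i)) (ε l) P P := fun i =>
    hε_ident _ (Nat.le_add_right l i)
  have habs : ∀ β ∈ Set.Icc (-1 : ℝ) 1, |β| ≤ 1 := fun β hβ => abs_le.2 hβ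
  constructor
  · intro β hβ c
    -- Finiteness needs only the unconditional law: the noise energy diverges almost surely and the
    -- information dominates a quarter of it.
    refine cond_absolutelyContinuous.ae_le ?_
    have hdiv := SLS.ae_tendsto_sum_sq_atTop (P := P) (e := fun i => ε (l + i)) hpair hid hε_L2
      (by rw [add_zero, hsq]; positivity)
    filter_upwards [hdiv] with ω hω
    obtain ⟨n, hn⟩ := (hω.eventually_ge_atTop (4 * c)).exists
    refine ⟨l + n, Nat.le_add_right l n, ?_⟩
    have := SLS.sum_sq_noise_le (β := β) (e := fun i => ε (l + i) ω)
      (x := fun i => SLS.stream β (X₀ ω) (fun i => ε i ω) (l - 1 + i)) (habs β hβ)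
      (fun i => SLS.stream_succ_of_one_le hl1 i) n
    rw [SLS.blockInfo_eq_sum_range _ hl1, show l + n + 1 - l = n + 1 by omega]
    linarith
  · let A : Set.Icc (-1 : ℝ) 1 → Set Ω := fun β =>
      {ω | SLS.startTime Omg (SLS.stream β (X₀ ω) fun i => ε i ω) (fun j => U j ω) = l}
    have hOm := SLS.measurable_of_continuousAt_ne hOmg_cont
    have hA0 : ∀ β, MeasurableSet[SLS.pastFiltration hX₀ hε hU l 0] (A β) := fun β =>
      SLS.measurableSet_startTime_eq (β : ℝ) hl hOm (SLS.measurable_comap_past_start 0)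
        (fun i h1 h2 => SLS.measurable_comap_past_noise 0 h1 h2) (SLS.measurable_comap_past_trial 0)
    -- Pointwise positivity becomes a uniform lower bound because a continuous function attains its
    -- minimum on the compact interval.
    obtain ⟨d, hd, hAd⟩ : ∃ d > 0, ∀ β, d ≤ P.real (A β) := by
      have hcont := SLS.continuous_measureReal_startTime_eq hl hX₀ hε hU hOmg_cont hU_unif hU_stream
      obtain ⟨β₀, hβ₀, hmin⟩ := (isCompact_Icc (a := (-1 : ℝ)) (b := 1)).exists_isMinOn
        ⟨0, by norm_num, by norm_num⟩ hcont.continuousOn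
      exact ⟨_, ENNReal.toReal_pos (hstart β₀ hβ₀).ne' (measure_ne_top _ _),
        fun β => hmin β.2⟩
    have hkey : ∀ u θ : ℝ, 0 < θ → ∀ᶠ c in atTop, ∀ β : Set.Icc (-1 : ℝ) 1,
        ‖∫ ω in A β, Complex.exp ((u * (SLS.normalizedError β
          (SLS.stream β (X₀ ω) fun i => ε i ω) l c / σ) : ℝ) * Complex.I) ∂P
          - P.real (A β) * Real.exp (-(u ^ 2 / 2))‖ ≤ θ := fun u θ hθ => by
      filter_upwards [SLS.eventually_norm_setIntegral_exp_normalizedError_sub_le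
        (ℱ := SLS.pastFiltration hX₀ hε hU l) hl1 (SLS.measurable_comap_past_start 0)
        (fun i j h1 h2 => SLS.measurable_comap_past_noise i h1 h2) hε
        (fun i => (IndepFun_iff_Indep _ _ _).1
          (SLS.indepFun_past hl1 hX₀ hε hU hU_stream hε_indep hε_past i))
        hpair hid hε_L2 hε_mean hσ hsq u hθ] with c hc β
      exact hc β (habs β β.2) (A β) (hA0 β)
    have hmeas : ∀ (c : ℝ) (β : Set.Icc (-1 : ℝ) 1), Measurable fun ω =>
        SLS.normalizedError β (SLS.stream β (X₀ ω) fun i => ε i ω) l c / σ := fun c β =>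
      ((SLS.measurable_normalizedError (β : ℝ) l c).comp (measurable_pi_lambda _ fun k =>
        SLS.measurable_stream (β : ℝ) hX₀ fun i _ _ => hε i)).div_const σ
    rw [Metric.tendsto_nhds]
    intro θ hθ
    filter_upwards [SLS.eventually_forall_abs_cond_sub_cdf_le hd hAd hmeas hkey
      (half_pos hθ)] with c hc
    have hle : (⨆ β : Set.Icc (-1 : ℝ) 1, ⨆ x : ℝ, |(SLS.condLaw P X₀ ε U Omg l β).real
        {ω | SLS.normalizedError β (SLS.stream β (X₀ ω) (fun i => ε i ω)) l c ≤ x}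
          - cdf (gaussianReal 0 1) (x / σ)|) ≤ θ / 2 := by
      refine Real.iSup_le (fun β => Real.iSup_le (fun x => ?_) (half_pos hθ).le) (half_pos hθ).le
      have := hc β (x / σ)
      simp only [div_le_div_iff_of_pos_right hσ] at this
      exact this
    rw [Real.dist_eq, sub_zero, abs_of_nonneg
      (Real.iSup_nonneg fun β => Real.iSup_nonneg fun x => abs_nonneg _)]
    linarith
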